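/- Fix integers $d\ge 1$, $L\ge 1$ and reals $\sigma>0$, $x\ge 0$. For a finite graph (loops and multiple bonds allowed) with sites $V$, bonds $B$, Ising spins $S\in\{\pm1\}^V$ and $S_b=S_nS_{n'}$ for a bond $b=(n,n')$, let $J_b$ ($b\in B$) be independent Gaussians with mean $\mu_b$ and variance $\sigma^2$, and let $Z=\sum_S e^{\sum_b\beta_bJ_bS_b}$. Write $\langle\cdot\rangle$ for the Boltzmann–Gibbs expectation at fixed disorder, $[\cdot]$ for the average over the disorder, and $P=[\ln Z]$ for the pressure. On the Nishimori line $\beta_b=x_b/\sigma$ and $\mu_b=\sigma x_b$ with $x_b\ge 0$; unless said otherwise $x_b=x$ for all $b$. Let $P^{(\Phi)}_N$ be the pressure of the box $\{0,\dots,N-1\}^d$ with nearest-neighbour bonds (free boundary) and $P^{(\Pi)}_N$ that of the torus $\Pi_N=(\mathbb Z/N)^d$ with the $dN^d$ bonds $(n,n+e_i)$. For $k\ge 1$ divide the torus $\Pi_{kL}$ into boxes of side $L$, let $\mathcal C$ be the set of the $dL^{d-1}k^d$ bonds that join adjacent boxes (for $k=1$: the standard cut, along which $\Pi_L$ unfolds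 into the box), let $S_{\mathcal C}=|\mathcal C|^{-1}\sum_{b\in\mathcal C}S_b$, and for $t\in[0,1]$ let $[\langle\cdot\rangle_t^{(\Pi_{kL})}]_t$ be the quenched state on the Nishimori line with $x_b=x\sqrt t$ for $b\in\mathcal C$ and $x_b=x$ otherwise. Let $[\langle S_b\rangle_t^{(\Pi_{\infty L})}]_t=\lim_{k\to\infty}[\langle S_b\rangle_t^{(\Pi_{kL})}]_t$ for bonds $b$ of $\mathbb Z^d$ joining adjacent boxes of side $L$, and let $[\langle S_{\mathcal C}\rangle_t^{(\Pi_{\infty L})}]_t$ be its average over the $dL^{d-1}$ such bonds that leave one box in the positive directions. Then: 1. The limits of $P^{(\Phi)}_N/N^d$ and $P^{(\Pi)}_N/N^d$ as $N\to\infty$ exist and are equal; call the common value $p$. 2. For all but countably many $t\in[0,1]$ the limits defining $[\langle S_b\rangle_t^{(\Pi_{\infty L})}]_t$ exist for all corridor bonds $b$, and $[\langle S_{\mathcal C}\rangle_t^{(\Pi_{kL})}]_t\to[\langle S_{\mathcal C}\rangle_t^{(\Pi_{\infty L})}]_t$ as $k\to\infty$. The functions $t\mapsto[\langle S_{\mathcal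 C}\rangle_t^{(\Pi_{\infty L})}]_t$ and $t\mapsto[\langle S_{\mathcal C}\rangle_t^{(\Pi_{L})}]_t$ are integrable on $[0,1]$. 3. The surface pressure $T^{(\Phi)}_{\partial\Lambda}=P^{(\Phi)}_L-pL^d$ for free boundary conditions satisfies $$T^{(\Phi)}_{\partial\Lambda}=-\frac d2x^2L^{d-1}\Bigl(1+\int_0^1[\langle S_{\mathcal C}\rangle_t^{(\Pi_{\infty L})}]_t\,dt\Bigr).$$ It is nonpositive and of surface order: $\frac d2x^2L^{d-1}\le -T^{(\Phi)}_{\partial\Lambda}\le d\,x^2L^{d-1}$. 4. The surface pressure $T^{(\Pi)}_{\partial\Lambda}=P^{(\Pi)}_L-pL^d$ for periodic boundary conditions satisfies $$T^{(\Pi)}_{\partial\Lambda}=\frac12\,d\,x^2L^{d-1}\Bigl(\int_0^1[\langle S_{\mathcal C}\rangle_t^{(\Pi_L)}]_t\,dt-\int_0^1[\langle S_{\mathcal C}\rangle_t^{(\Pi_{\infty L})}]_t\,dt\Bigr).$$ -/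

import Mathlib

open Filter Topology MeasureTheory ProbabilityTheory

noncomputable section

namespace EA

section Model

/-! The Gaussian Edwards-Anderson model on a finite (multi)graph: `V` is the set of sites, `B` the
set of bonds, and `e b` is the pair of end points of the bond `b`. -/

variable {V B : Type} [Fintype V] [DecidableEq V] [Fintype B]

/-- The bond spin `S_b = S_n S_n'` of the bond `b = (n, n')`. -/
def bondSpin (e : B → V × V) (S : V → ℤˣ) (b : B) : ℝ :=
  ((S (e b).1 : ℤ) : ℝ) * ((S (e b).2 : ℤ) : ℝ)

/-- The potential `U = ∑_b β_b J_b S_b`. -/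
def potential (e : B → V × V) (β J : B → ℝ) (S : V → ℤˣ) : ℝ :=
  ∑ b, β b * J b * bondSpin e S b

/-- The partition function `∑_S exp U`. -/
def partitionFn (e : B → V × V) (β J : B → ℝ) : ℝ :=
  ∑ S : V → ℤˣ, Real.exp (potential e β J S)

/-- The Boltzmann-Gibbs expectation `⟨f⟩` at fixed disorder `J`. -/
def gibbs (e : B → V × V) (β J : B → ℝ) (f : (V → ℤˣ) → ℝ) : ℝ :=
  (∑ S : V → ℤˣ, f S * Real.exp (potential e β J S)) / partitionFn e β J

/-- The law of the disorder: independent Gaussian `J_b` with mean `μ_b` and variance `σ_b ^ 2`. -/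
def disorder (μ σ : B → ℝ) : Measure (B → ℝ) :=
  Measure.pi fun b => gaussianReal (μ b) (Real.toNNReal (σ b ^ 2))

/-- The quenched pressure `[log Z]`. -/
def pressure (e : B → V × V) (β μ σ : B → ℝ) : ℝ :=
  ∫ J, Real.log (partitionFn e β J) ∂(disorder μ σ)

/-- The quenched expectation `[⟨f⟩]`. -/
def quenched (e : B → V × V) (β μ σ : B → ℝ) (f : (V → ℤˣ) → ℝ) : ℝ :=
  ∫ J, gibbs e β J f ∂(disorder μ σ)

/-- The quenched pressure on the (generalized) Nishimori line: `β_b = x_b / σ_b` and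
`μ_b = σ_b x_b`. -/
def nlPressure (e : B → V × V) (σ x : B → ℝ) : ℝ :=
  pressure e (fun b => x b / σ b) (fun b => σ b * x b) σ

/-- The quenched expectation on the (generalized) Nishimori line. -/
def nlQuenched (e : B → V × V) (σ x : B → ℝ) (f : (V → ℤˣ) → ℝ) : ℝ :=
  quenched e (fun b => x b / σ b) (fun b => σ b * x b) σ f

end Model

/-! ### The box with free boundary conditions -/

/-- The bonds of the box `{0, …, N - 1} ^ d`: the pair `(n, i)` with `n i + 1 < N` is the bond that
joins `n` to its neighbour in the positive direction `i`. -/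
abbrev FreeBond (d N : ℕ) : Type :=
  {b : (Fin d → Fin N) × Fin d // (b.1 b.2 : ℕ) + 1 < N}

/-- End points of the bonds of the box. -/
def freeEnds (d N : ℕ) (b : FreeBond d N) : (Fin d → Fin N) × (Fin d → Fin N) :=
  (b.1.1, Function.update b.1.1 b.1.2 ⟨(b.1.1 b.1.2 : ℕ) + 1, b.2⟩)

/-- The pressure of the box of side `N` with free boundary conditions, on the Nishimori line. -/
def freePressure (d N : ℕ) (σ x : ℝ) : ℝ :=
  nlPressure (freeEnds d N) (fun _ => σ) (fun _ => x)

/-! ### The torus (periodic boundary conditions) -/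

/-- The bonds of the torus `(ℤ / N) ^ d`: the pair `(n, i)` is the bond from `n` to `n + e_i`, so
that there are `d * N ^ d` bonds for every `N`. -/
abbrev TorusBond (d N : ℕ) : Type := (Fin d → ZMod N) × Fin d

/-- End points of the bonds of the torus. -/
def torusEnds (d N : ℕ) (b : TorusBond d N) : (Fin d → ZMod N) × (Fin d → ZMod N) :=
  (b.1, b.1 + Pi.single b.2 1)

/-- The corridor: the bonds of the torus of side `N` (a multiple of `L`) that join two adjacent
boxes of side `L` among those which compose the torus. For `N = L` it is the standard cut, along
which the torus unfolds into the box of side `L`. -/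
def corridor (d N L : ℕ) [NeZero N] : Finset (TorusBond d N) :=
  Finset.univ.filter fun b => L ∣ (b.1 b.2).val + 1

/-- The interpolation scheme: `x √t` on the corridor and `x` on all other bonds. -/
def interp (d N L : ℕ) [NeZero N] (x t : ℝ) (b : TorusBond d N) : ℝ :=
  if b ∈ corridor d N L then x * Real.sqrt t else x

/-- The pressure of the torus of side `N`, on the Nishimori line. -/
def torusPressure (d N : ℕ) [NeZero N] (σ x : ℝ) : ℝ :=
  nlPressure (torusEnds d N) (fun _ => σ) (fun _ => x)

/-- `[⟨f⟩_t]_t` on the torus of side `N`, interpolated along the corridor. -/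
def torusQuenched (d N L : ℕ) [NeZero N] (σ x t : ℝ) (f : ((Fin d → ZMod N) → ℤˣ) → ℝ) : ℝ :=
  nlQuenched (torusEnds d N) (fun _ => σ) (interp d N L x t) f

/-- The average bond spin `S_C = |C|⁻¹ ∑_{b ∈ C} S_b` on the corridor of the torus. -/
def corridorSpin (d N L : ℕ) [NeZero N] (S : (Fin d → ZMod N) → ℤˣ) : ℝ :=
  ((corridor d N L).card : ℝ)⁻¹ * ∑ b ∈ corridor d N L, bondSpin (torusEnds d N) S b

/-- `[⟨S_C⟩_t]_t` on the torus of side `N` composed of boxes of side `L`. -/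
def torusCorridorMean (d N L : ℕ) [NeZero N] (σ x t : ℝ) : ℝ :=
  torusQuenched d N L σ x t (corridorSpin d N L)

/-- The bond correlation `[⟨S_b⟩_t]_t` on the torus of side `N` composed of boxes of side `L`, for
the image in the torus of the bond `b = (n, n + e_i)` of the lattice `ℤ ^ d`. -/
def torusCorr (d N L : ℕ) [NeZero N] (σ x t : ℝ) (n : Fin d → ℤ) (i : Fin d) : ℝ :=
  torusQuenched d N L σ x t
    (fun S => bondSpin (torusEnds d N) S (fun j => ((n j : ℤ) : ZMod N), i))

/-! ### The infinite periodic system and the surface pressures -/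

/-- The bond correlation `[⟨S_b⟩_t]_t` of the infinite system on `ℤ ^ d` made up of boxes of side
`L`: the limit, as `k → ∞`, of that of the torus of side `k L`. -/
def infCorr (d L : ℕ) [NeZero L] (σ x t : ℝ) (n : Fin d → ℤ) (i : Fin d) : ℝ :=
  limUnder atTop fun k : ℕ => torusCorr d ((k + 1) * L) L σ x t n i

/-- The corridor bonds of the infinite system up to translations by `L ℤ ^ d`: the bonds that leave
the box `{0, …, L - 1} ^ d` in a positive direction. -/
def cellCorridor (d L : ℕ) : Finset ((Fin d → Fin L) × Fin d) :=
  Finset.univ.filter fun b => (b.1 b.2 : ℕ) + 1 = L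

/-- `[⟨S_C⟩_t]_t` for the infinite system: the average of the bond correlations over the
corridor. -/
def infCorridorMean (d L : ℕ) [NeZero L] (σ x t : ℝ) : ℝ :=
  ((cellCorridor d L).card : ℝ)⁻¹ *
    ∑ b ∈ cellCorridor d L, infCorr d L σ x t (fun j => ((b.1 j : ℕ) : ℤ)) b.2

/-- The limiting pressure per site `p`. -/
def limitPressure (d : ℕ) (σ x : ℝ) : ℝ :=
  limUnder atTop fun N : ℕ => freePressure d N σ x / (N : ℝ) ^ d

/-- The surface pressure `P_Λ - p |Λ|` of the box of side `L`, free boundary conditions. -/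
def freeSurface (d L : ℕ) (σ x : ℝ) : ℝ :=
  freePressure d L σ x - limitPressure d σ x * (L : ℝ) ^ d

/-- The surface pressure `P_Λ - p |Λ|` of the box of side `L`, periodic boundary conditions. -/
def torusSurface (d L : ℕ) [NeZero L] (σ x : ℝ) : ℝ :=
  torusPressure d L σ x - limitPressure d σ x * (L : ℝ) ^ d

end EA

end

/-! With `J_b = μ_b + σ g_b` and `g` standard Gaussian, the local fields on the Nishimori line are
`x_b ^ 2 + x_b g_b`, so `σ` drops out. The Cameron-Martin formula and an average over gauge
transformations turn both `[⟨S_b⟩]` and `[⟨S_b⟩ ^ 2]` into the same constant times the integral of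
`A ^ 2 / Z` over centred fields `x_b g_b`, where `A` is the unnormalized expectation of `S_b`. This
Nishimori identity (`integral_mean_sq`) makes the bond expectations nonnegative. Since `A ^ 2 / Z`
is jointly convex in `(A, Z)`, adding independent Gaussian fields increases its suitably normalized
integral by Jensen's inequality, so bond expectations increase with the couplings (`nlM_mono`) and
with the graph (`nlM_le_of_embedding`).

Gaussian integration by parts and the Nishimori identity give `∂P/∂x_b = x_b (1 + [⟨S_b⟩])`
(`hasDerivAt_nlP`). With `x √t` on the corridor, the derivative of the pressure in `t` is `x ^ 2 /
2` times the corridor sum of `1 + [⟨S_b⟩_t]_t`. At `t = 0` the torus of side `k L` splits into `k ^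
d` free boxes and at `t = 1` it is homogeneous; integration gives an exact formula for its pressure
(`torusPressure_eq`). The case `k = 1` compares torus and box, the limit `k → ∞` compares `p` and
box.

It remains to take the limit under the integral. Cutting a torus into boxes costs a surface term, so
the interpolated pressures per box of tori and of free boxes have a common limit. They are convex in
`t` for `t ≥ 0`, hence outside a countable set their slopes have a common limit too
(`exists_tendsto_slope`). Free-box correlations are at most the lower limits of the torus
correlations. Equality of the limiting slopes therefore leaves no room for oscillation, and every
corridor correlation converges (`tendsto_of_sum_le`). Dominated convergence concludes. -/

noncomputable section

namespace EA

/-! ### Gaussian vectors: affine images, Cameron-Martin formula, integration by parts. -/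

section GaussianVectors

variable {B : Type} [Fintype B]

/-- The law of a family of independent standard Gaussians. -/
def stdG (B : Type) [Fintype B] : Measure (B → ℝ) :=
  Measure.pi fun _ => gaussianReal 0 1

instance : IsProbabilityMeasure (stdG B) := by unfold stdG; infer_instance

lemma map_affine_gaussianReal (a c : ℝ) :
    (gaussianReal 0 1).map (fun z => a + c * z) = gaussianReal a (Real.toNNReal (c ^ 2)) := by
  have h : (fun z : ℝ => a + c * z) = (fun z => a + z) ∘ (fun z => c * z) := rfl
  rw [h, ← Measure.map_map (by fun_prop) (by fun_prop), gaussianReal_map_const_mul,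
    gaussianReal_map_const_add]
  congr 1
  · ring
  · rw [mul_one]
    ext
    simp [Real.coe_toNNReal _ (sq_nonneg c)]

lemma stdG_map_affine (a c : B → ℝ) :
    (stdG B).map (fun g b => a b + c b * g b)
      = Measure.pi fun b => gaussianReal (a b) (Real.toNNReal (c b ^ 2)) := by
  have hf : ∀ b, Measurable fun z : ℝ => a b + c b * z := fun b => by fun_prop
  have inst : ∀ b, SigmaFinite ((gaussianReal 0 1).map (fun z : ℝ => a b + c b * z)) := fun b => by
    rw [map_affine_gaussianReal]; infer_instance
  rw [stdG, Measure.pi_map_pi (f := fun b z => a b + c b * z) (fun b => (hf b).aemeasurable)]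
  simp_rw [map_affine_gaussianReal]

/-- Symmetry of the centred Gaussian: this is what lets gauge transformations act on the disorder.
-/
lemma measurePreserving_sign (s : B → ℝ) (hs : ∀ b, s b ^ 2 = 1) :
    MeasurePreserving (fun (g : B → ℝ) b => s b * g b) (stdG B) (stdG B) := by
  refine ⟨by fun_prop, ?_⟩
  have := stdG_map_affine (fun _ => 0) s
  simpa [hs, stdG] using this

/-- Independence passes to subfamilies, so the disorder seen by a subgraph is again standard. -/
lemma measurePreserving_comp {B' : Type} [Fintype B'] (ψ : B → B') (hψ : ψ.Injective) :
    MeasurePreserving (fun (g : B' → ℝ) b => g (ψ b)) (stdG B') (stdG B) := by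
  refine ⟨by fun_prop, ?_⟩
  have h : iIndepFun (fun (b : B') (g : B' → ℝ) => g b) (stdG B') :=
    iIndepFun_pi (X := fun _ => id) (fun _ => aemeasurable_id)
  have h2 := h.precomp hψ
  rw [iIndepFun_iff_map_fun_eq_pi_map (fun b => (measurable_pi_apply (ψ b)).aemeasurable)] at h2
  have h3 : ∀ b : B', (stdG B').map (fun g => g b) = gaussianReal 0 1 := fun b =>
    (measurePreserving_eval (fun _ : B' => gaussianReal 0 1) b).map_eq
  simp only [h3] at h2
  exact h2

/-- A sum of independent centred Gaussian vectors with independent coordinates. -/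
lemma stdG_map_add (x w y : B → ℝ) (h : ∀ b, x b ^ 2 + w b ^ 2 = y b ^ 2) :
    ((stdG B).prod (stdG B)).map (fun p b => x b * p.1 b + w b * p.2 b)
      = (stdG B).map (fun g b => y b * g b) := by
  have h1 := stdG_map_affine (fun _ => 0) y
  simp only [zero_add] at h1
  rw [h1]
  -- Regrouping a pair of vectors as a vector of pairs leaves one convolution of two Gaussians per
  -- coordinate.
  have h2 := measurePreserving_arrowProdEquivProdArrow ℝ ℝ B (fun _ => gaussianReal 0 1)
    (fun _ => gaussianReal 0 1)
  rw [stdG, ← h2.map_eq, Measure.map_map (by fun_prop) h2.measurable]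
  have key : ∀ b, ((gaussianReal 0 1).prod (gaussianReal 0 1)).map
      (fun q : ℝ × ℝ => x b * q.1 + w b * q.2) = gaussianReal 0 (Real.toNNReal (y b ^ 2)) := by
    intro b
    have h3 : (fun q : ℝ × ℝ => x b * q.1 + w b * q.2)
        = (fun q : ℝ × ℝ => q.1 + q.2) ∘ Prod.map (fun z => 0 + x b * z) (fun z => 0 + w b * z) := by
      ext q; simp
    rw [h3, ← Measure.map_map (by fun_prop) (by fun_prop),
      ← Measure.map_prod_map _ _ (by fun_prop) (by fun_prop), map_affine_gaussianReal,
      map_affine_gaussianReal]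
    have h4 := gaussianReal_conv_gaussianReal (m₁ := 0) (m₂ := 0)
      (v₁ := Real.toNNReal (x b ^ 2)) (v₂ := Real.toNNReal (w b ^ 2))
    rw [Measure.conv] at h4
    rw [h4, ← Real.toNNReal_add (sq_nonneg _) (sq_nonneg _), h b, add_zero]
  have inst : ∀ b, SigmaFinite (((gaussianReal 0 1).prod (gaussianReal 0 1)).map
      (fun q : ℝ × ℝ => x b * q.1 + w b * q.2)) := fun b => by rw [key]; infer_instance
  have h5 := Measure.pi_map_pi (μ := fun _ : B => (gaussianReal 0 1).prod (gaussianReal 0 1))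
    (f := fun b (q : ℝ × ℝ) => x b * q.1 + w b * q.2) (fun b => by fun_prop)
  simp_rw [key] at h5
  exact h5

lemma gaussianReal_eq_withDensity (a : ℝ) :
    gaussianReal a 1
      = (gaussianReal 0 1).withDensity (fun z => ENNReal.ofReal (Real.exp (a * z - a ^ 2 / 2))) := by
  rw [gaussianReal_of_var_ne_zero _ one_ne_zero, gaussianReal_of_var_ne_zero _ one_ne_zero,
    ← withDensity_mul _ (by fun_prop) (by fun_prop)]
  congr 1
  ext z
  simp only [Pi.mul_apply, gaussianPDF_def]
  rw [← ENNReal.ofReal_mul (gaussianPDFReal_nonneg _ _ _)]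
  simp only [gaussianPDFReal_def]
  rw [mul_assoc _ (Real.exp _) (Real.exp _), ← Real.exp_add]
  congr 3
  simp only [NNReal.coe_one]
  ring

lemma stdG_map_shift (x : B → ℝ) :
    (stdG B).map (fun g b => x b + g b) = (stdG B).withDensity
      (fun g => ENNReal.ofReal (Real.exp (∑ b, (x b * g b - x b ^ 2 / 2)))) := by
  have h1 := stdG_map_affine x (fun _ => 1)
  simp only [one_mul, one_pow, Real.toNNReal_one] at h1
  rw [h1]
  refine Measure.pi_eq fun s hs => ?_
  rw [withDensity_apply _ (MeasurableSet.univ_pi hs), ← lintegral_indicator (MeasurableSet.univ_pi hs)]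
  -- On a box the density and the indicator both factorize over the coordinates, and independence
  -- does the rest.
  have h2 : ∀ g : B → ℝ, (Set.univ.pi s).indicator
      (fun g => ENNReal.ofReal (Real.exp (∑ b, (x b * g b - x b ^ 2 / 2)))) g
      = ∏ b, (s b).indicator (fun z => ENNReal.ofReal (Real.exp (x b * z - x b ^ 2 / 2))) (g b) := by
    intro g
    by_cases hg : g ∈ Set.univ.pi s
    · rw [Set.indicator_of_mem hg, Real.exp_sum, ENNReal.ofReal_prod_of_nonneg
        (fun _ _ => (Real.exp_pos _).le)]
      refine Finset.prod_congr rfl fun b _ => ?_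
      rw [Set.indicator_of_mem (hg b (Set.mem_univ b))]
    · rw [Set.indicator_of_notMem hg]
      simp only [Set.mem_pi, Set.mem_univ, true_implies, not_forall] at hg
      obtain ⟨b, hb⟩ := hg
      exact (Finset.prod_eq_zero (Finset.mem_univ b) (Set.indicator_of_notMem hb _)).symm
  have hm : ∀ b, Measurable ((s b).indicator
      (fun z => ENNReal.ofReal (Real.exp (x b * z - x b ^ 2 / 2)))) := fun b =>
    Measurable.indicator (by fun_prop) (hs b)
  have hind : iIndepFun (fun b (g : B → ℝ) => (s b).indicator
      (fun z => ENNReal.ofReal (Real.exp (x b * z - x b ^ 2 / 2))) (g b)) (stdG B) :=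
    iIndepFun_pi (fun b => (hm b).aemeasurable)
  simp_rw [h2]
  rw [lintegral_prod_eq_prod_lintegral_of_indepFun Finset.univ _ hind
    (fun b => (hm b).comp (measurable_pi_apply b))]
  refine Finset.prod_congr rfl fun b _ => ?_
  have h3 := (measurePreserving_eval (fun _ : B => gaussianReal 0 1) b).lintegral_comp (hm b)
  rw [gaussianReal_eq_withDensity, withDensity_apply _ (hs b), ← lintegral_indicator (hs b)]
  exact h3

/-- The Cameron-Martin formula for a finite family of standard Gaussians. -/
lemma integral_stdG_shift (x : B → ℝ) (F : (B → ℝ) → ℝ) :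
    ∫ g, F (fun b => x b + g b) ∂(stdG B)
      = ∫ g, Real.exp (∑ b, (x b * g b - x b ^ 2 / 2)) * F g ∂(stdG B) := by
  have h1 : MeasurableEmbedding (fun (g : B → ℝ) b => x b + g b) :=
    (MeasurableEquiv.addLeft x).measurableEmbedding
  rw [← h1.integral_map, stdG_map_shift, integral_withDensity_eq_integral_toReal_smul
    (by fun_prop) (ae_of_all _ fun _ => ENNReal.ofReal_lt_top)]
  simp [ENNReal.toReal_ofReal (Real.exp_pos _).le]

/-- Resampling one coordinate does not change the law. This isolates the coordinate `b` for a
one-dimensional integration by parts without splitting the index set. -/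
lemma measurePreserving_update [DecidableEq B] (b : B) :
    MeasurePreserving (fun p : (B → ℝ) × ℝ => Function.update p.1 b p.2)
      ((stdG B).prod (gaussianReal 0 1)) (stdG B) := by
  have hm : Measurable (fun p : (B → ℝ) × ℝ => Function.update p.1 b p.2) := by
    refine measurable_pi_lambda _ fun c => ?_
    by_cases h : c = b
    · subst h; simpa using measurable_snd
    · simp only [Function.update_of_ne h]; fun_prop
  refine ⟨hm, ?_⟩
  symm
  refine Measure.pi_eq fun s hs => ?_
  rw [Measure.map_apply hm (MeasurableSet.univ_pi hs)]
  have h1 : (fun p : (B → ℝ) × ℝ => Function.update p.1 b p.2) ⁻¹' (Set.univ.pi s)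
      = (Set.univ.pi (Function.update s b Set.univ)) ×ˢ s b := by
    ext p
    simp only [Set.mem_preimage, Set.mem_pi, Set.mem_univ, true_implies, Set.mem_prod]
    constructor
    · intro h
      refine ⟨fun c => ?_, by simpa using h b⟩
      by_cases hc : c = b
      · subst hc; simp
      · simpa [hc] using h c
    · rintro ⟨h, h'⟩ c
      by_cases hc : c = b
      · subst hc; simpa using h'
      · simpa [hc] using h c
  rw [h1, Measure.prod_prod, stdG, Measure.pi_pi, ← Finset.mul_prod_erase _ _ (Finset.mem_univ b),
    ← Finset.mul_prod_erase (Finset.univ) (fun i => (gaussianReal 0 1) (s i)) (Finset.mem_univ b)]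
  rw [Function.update_self, measure_univ, one_mul, mul_comm]
  congr 1
  refine Finset.prod_congr rfl fun c hc => ?_
  rw [Function.update_of_ne (Finset.ne_of_mem_erase hc)]

lemma hasDerivAt_gaussianPDFReal (z : ℝ) :
    HasDerivAt (gaussianPDFReal 0 1) (-(z * gaussianPDFReal 0 1 z)) z := by
  have : gaussianPDFReal 0 1 = fun z => (√(2 * Real.pi * (1 : NNReal)))⁻¹ * Real.exp (-(z - 0) ^ 2 / (2 * (1 : NNReal))) :=
    gaussianPDFReal_def 0 1
  rw [this]
  have h1 : HasDerivAt (fun z : ℝ => -(z - 0) ^ 2 / (2 * ((1 : NNReal) : ℝ))) (-z) z := by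
    have := ((((hasDerivAt_id z).sub_const 0).pow 2).neg).div_const (2 * ((1 : NNReal) : ℝ))
    refine this.congr_deriv ?_
    simp
    ring
  refine (h1.exp.const_mul ((√(2 * Real.pi * (1 : NNReal)))⁻¹)).congr_deriv ?_
  ring

/-- Gaussian integration by parts on the line. -/
lemma integral_mul_gaussianReal (F F' : ℝ → ℝ) (hF : ∀ z, HasDerivAt F (F' z) z)
    (hF'm : Measurable F') (K : ℝ) (hK : ∀ z, |F z| ≤ K) (hK' : ∀ z, |F' z| ≤ K) :
    ∫ z, z * F z ∂(gaussianReal 0 1) = ∫ z, F' z ∂(gaussianReal 0 1) := by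
  have hFc : Continuous F := continuous_iff_continuousAt.2 fun z => (hF z).continuousAt
  have hid : Integrable (fun z : ℝ => z * gaussianPDFReal 0 1 z) := by
    have h1 : Integrable (fun z : ℝ => z) (gaussianReal 0 1) :=
      (memLp_id_gaussianReal 1).integrable (by simp)
    rw [gaussianReal_of_var_ne_zero _ one_ne_zero, integrable_withDensity_iff_integrable_smul'
      (by fun_prop) (ae_of_all _ fun _ => gaussianPDF_lt_top)] at h1
    simpa [mul_comm] using h1
  have hp := integrable_gaussianPDFReal 0 1
  have h := integral_mul_deriv_eq_deriv_mul_of_integrable (u := F) (v := gaussianPDFReal 0 1)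
    (u' := F') (v' := fun z => -(z * gaussianPDFReal 0 1 z)) (fun z _ => hF z)
    (fun z _ => hasDerivAt_gaussianPDFReal z) ?_ ?_ ?_
  · rw [integral_gaussianReal_eq_integral_smul one_ne_zero,
      integral_gaussianReal_eq_integral_smul one_ne_zero]
    simp only [smul_eq_mul]
    have e1 : ∀ z, gaussianPDFReal 0 1 z * (z * F z) = - (F z * -(z * gaussianPDFReal 0 1 z)) :=
      fun z => by ring
    simp_rw [e1, integral_neg, h, neg_neg, mul_comm]
  · exact hid.neg.bdd_mul hFc.aestronglyMeasurable (ae_of_all _ fun z => hK z)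
  · exact hp.bdd_mul hF'm.aestronglyMeasurable (ae_of_all _ fun z => hK' z)
  · exact hp.bdd_mul hFc.aestronglyMeasurable (ae_of_all _ fun z => hK z)

lemma integrable_stdG_eval (b : B) : Integrable (fun g => g b) (stdG B) := by
  have h1 : Integrable (fun z : ℝ => z) (gaussianReal 0 1) :=
    (memLp_id_gaussianReal 1).integrable (by simp)
  exact (measurePreserving_eval (fun _ : B => gaussianReal 0 1) b).integrable_comp_of_integrable h1

/-- Gaussian integration by parts in the coordinate `b`. -/
lemma integral_mul_stdG [DecidableEq B] (b : B) (F F' : (B → ℝ) → ℝ)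
    (hF : ∀ g z, HasDerivAt (fun z => F (Function.update g b z)) (F' (Function.update g b z)) z)
    (hFm : Measurable F) (hF'm : Measurable F') (K : ℝ) (hK : ∀ g, |F g| ≤ K)
    (hK' : ∀ g, |F' g| ≤ K) :
    ∫ g, g b * F g ∂(stdG B) = ∫ g, F' g ∂(stdG B) := by
  have hmp := measurePreserving_update b
  have hint : Integrable (fun g => g b * F g) (stdG B) :=
    (integrable_stdG_eval b).mul_bdd hFm.aestronglyMeasurable (ae_of_all _ fun g => hK g)
  have hint' : Integrable F' (stdG B) :=
    Integrable.of_bound hF'm.aestronglyMeasurable K (ae_of_all _ fun g => hK' g)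
  rw [← hmp.map_eq, integral_map hmp.measurable.aemeasurable, integral_map hmp.measurable.aemeasurable,
    integral_prod, integral_prod]
  · refine integral_congr_ae (ae_of_all _ fun g => ?_)
    simp only [Function.update_self]
    refine integral_mul_gaussianReal _ _ (hF g) ?_ K (fun _ => hK _) (fun _ => hK' _)
    exact hF'm.comp (by fun_prop)
  · exact hmp.integrable_comp_of_integrable hint'
  · exact hmp.integrable_comp_of_integrable hint
  · rw [hmp.map_eq]; exact hF'm.aestronglyMeasurable
  · rw [hmp.map_eq]; exact ((measurable_pi_apply b).mul hFm).aestronglyMeasurable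

end GaussianVectors

/-! ### Gibbs states in given local fields: bounds, derivatives, gauge covariance. -/

section GibbsState

variable {V B : Type} [Fintype V] [DecidableEq V] [Fintype B]

/-- The Boltzmann weight in the local fields `h`. -/
def weight (e : B → V × V) (h : B → ℝ) (S : V → ℤˣ) : ℝ :=
  Real.exp (∑ b, h b * bondSpin e S b)

/-- The unnormalized expectation of `a`. -/
def wsum (e : B → V × V) (h : B → ℝ) (a : (V → ℤˣ) → ℝ) : ℝ :=
  ∑ S, a S * weight e h S

/-- The partition function in the local fields `h`. -/
def Zf (e : B → V × V) (h : B → ℝ) : ℝ := wsum e h fun _ => 1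

/-- The Boltzmann-Gibbs expectation of the bond spin `S_b`. -/
def mean (e : B → V × V) (h : B → ℝ) (b : B) : ℝ :=
  wsum e h (fun S => bondSpin e S b) / Zf e h

lemma unit_cast_sq (u : ℤˣ) : ((u : ℤ) : ℝ) * ((u : ℤ) : ℝ) = 1 := by
  rcases Int.units_eq_one_or u with h | h <;> simp [h]

omit [Fintype V] [DecidableEq V] [Fintype B] in
lemma bondSpin_mul_self (e : B → V × V) (S : V → ℤˣ) (b : B) :
    bondSpin e S b * bondSpin e S b = 1 := by
  unfold bondSpin
  linear_combination (((S (e b).2 : ℤ) : ℝ) * ((S (e b).2 : ℤ) : ℝ)) * unit_cast_sq (S (e b).1) +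
    unit_cast_sq (S (e b).2)

omit [Fintype V] [DecidableEq V] [Fintype B] in
lemma abs_bondSpin (e : B → V × V) (S : V → ℤˣ) (b : B) : |bondSpin e S b| = 1 := by
  have h := bondSpin_mul_self e S b
  rw [← abs_mul_abs_self] at h
  nlinarith [abs_nonneg (bondSpin e S b)]

omit [Fintype V] [DecidableEq V] [Fintype B] in
lemma bondSpin_mul (e : B → V × V) (S T : V → ℤˣ) (b : B) :
    bondSpin e (S * T) b = bondSpin e S b * bondSpin e T b := by
  simp only [bondSpin, Pi.mul_apply, Units.val_mul, Int.cast_mul]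
  ring

omit [Fintype V] [DecidableEq V] in
lemma weight_pos (e : B → V × V) (h : B → ℝ) (S : V → ℤˣ) : 0 < weight e h S := Real.exp_pos _

lemma Zf_pos (e : B → V × V) (h : B → ℝ) : 0 < Zf e h :=
  Finset.sum_pos (fun S _ => by simpa using weight_pos e h S) Finset.univ_nonempty

lemma abs_wsum_le (e : B → V × V) (h : B → ℝ) (a : (V → ℤˣ) → ℝ) (ha : ∀ S, |a S| ≤ 1) :
    |wsum e h a| ≤ Zf e h := by
  refine (Finset.abs_sum_le_sum_abs _ _).trans (Finset.sum_le_sum fun S _ => ?_)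
  rw [abs_mul, abs_of_pos (weight_pos e h S)]
  exact mul_le_mul_of_nonneg_right (ha S) (weight_pos e h S).le

lemma abs_mean_le (e : B → V × V) (h : B → ℝ) (b : B) : |mean e h b| ≤ 1 := by
  rw [mean, abs_div, abs_of_pos (Zf_pos e h), div_le_one (Zf_pos e h)]
  exact abs_wsum_le e h _ fun S => (abs_bondSpin e S b).le

omit [Fintype V] [DecidableEq V] in
lemma continuous_weight (e : B → V × V) (S : V → ℤˣ) : Continuous fun h => weight e h S := by
  unfold weight; fun_prop

lemma continuous_wsum (e : B → V × V) (a : (V → ℤˣ) → ℝ) : Continuous fun h => wsum e h a := by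
  have := continuous_weight e
  unfold wsum; fun_prop

lemma continuous_Zf (e : B → V × V) : Continuous fun h => Zf e h := continuous_wsum e _

lemma continuous_mean (e : B → V × V) (b : B) : Continuous fun h => mean e h b :=
  (continuous_wsum e _).div (continuous_Zf e) fun h => (Zf_pos e h).ne'

omit [Fintype V] [DecidableEq V] in
lemma abs_energy_le (e : B → V × V) (h : B → ℝ) (S : V → ℤˣ) :
    |∑ b, h b * bondSpin e S b| ≤ ∑ b, |h b| := by
  refine (Finset.abs_sum_le_sum_abs _ _).trans (Finset.sum_le_sum fun b _ => ?_)
  rw [abs_mul, abs_bondSpin, mul_one]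

/-- Below, `Z` is compared with its single term `S = 1`; above, with the number of configurations
times the largest possible weight. The bound is linear in `|h|`, hence integrable against Gaussians.
-/
lemma abs_log_Zf_le (e : B → V × V) (h : B → ℝ) :
    |Real.log (Zf e h)| ≤ Real.log (Fintype.card (V → ℤˣ)) + ∑ b, |h b| := by
  have hc : (0 : ℝ) < Fintype.card (V → ℤˣ) := by exact_mod_cast Fintype.card_pos
  have hc1 : (1 : ℝ) ≤ Fintype.card (V → ℤˣ) := by exact_mod_cast Fintype.card_pos
  have hl : 0 ≤ Real.log (Fintype.card (V → ℤˣ)) := Real.log_nonneg hc1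
  rw [abs_le]
  constructor
  · have h1 : Real.exp (-∑ b, |h b|) ≤ Zf e h := by
      have : weight e h 1 ≤ Zf e h := by
        have := Finset.single_le_sum (f := fun S => 1 * weight e h S)
          (fun S _ => by simpa using (weight_pos e h S).le) (Finset.mem_univ 1)
        simpa [Zf, wsum] using this
      refine le_trans (Real.exp_le_exp.2 ?_) this
      exact (abs_le.1 (abs_energy_le e h 1)).1
    have := Real.log_le_log (Real.exp_pos _) h1
    rw [Real.log_exp] at this
    linarith
  · have h1 : Zf e h ≤ Fintype.card (V → ℤˣ) * Real.exp (∑ b, |h b|) := by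
      have := Finset.sum_le_card_nsmul Finset.univ (fun S => 1 * weight e h S)
        (Real.exp (∑ b, |h b|)) fun S _ => by
          rw [one_mul]; exact Real.exp_le_exp.2 (abs_le.1 (abs_energy_le e h S)).2
      simpa [Zf, wsum] using this
    have := Real.log_le_log (Zf_pos e h) h1
    rwa [Real.log_mul hc.ne' (Real.exp_pos _).ne', Real.log_exp] at this

lemma hasDerivAt_wsum (e : B → V × V) (a : (V → ℤˣ) → ℝ) (h : ℝ → B → ℝ) (h' : B → ℝ) (t : ℝ)
    (hh : ∀ b, HasDerivAt (fun t => h t b) (h' b) t) :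
    HasDerivAt (fun t => wsum e (h t) a)
      (wsum e (h t) fun S => a S * ∑ b, h' b * bondSpin e S b) t := by
  unfold wsum
  refine HasDerivAt.fun_sum fun S _ => ?_
  have h1 : HasDerivAt (fun t => ∑ b, h t b * bondSpin e S b) (∑ b, h' b * bondSpin e S b) t :=
    HasDerivAt.fun_sum fun b _ => (hh b).mul_const _
  refine (h1.exp.const_mul (a S)).congr_deriv ?_
  simp only [weight]
  ring

lemma hasDerivAt_log_Zf (e : B → V × V) (h : ℝ → B → ℝ) (h' : B → ℝ) (t : ℝ)
    (hh : ∀ b, HasDerivAt (fun t => h t b) (h' b) t) :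
    HasDerivAt (fun t => Real.log (Zf e (h t))) (∑ b, h' b * mean e (h t) b) t := by
  refine ((hasDerivAt_wsum e (fun _ => 1) h h' t hh).log (Zf_pos e (h t)).ne').congr_deriv ?_
  simp only [mean, wsum, one_mul, Finset.sum_mul]
  rw [Finset.sum_comm, Finset.sum_div]
  refine Finset.sum_congr rfl fun b _ => ?_
  rw [← mul_div_assoc, Finset.mul_sum]
  simp [Zf, wsum, mul_assoc]

/-- The derivative of a bond expectation in its own field. -/
lemma hasDerivAt_mean (e : B → V × V) (b : B) (h : ℝ → B → ℝ) (c t : ℝ)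
    (hb : HasDerivAt (fun t => h t b) c t) (hne : ∀ b' ≠ b, ∀ t, h t b' = h 0 b') :
    HasDerivAt (fun t => mean e (h t) b) (c * (1 - mean e (h t) b ^ 2)) t := by
  classical
  have hh : ∀ b', HasDerivAt (fun t => h t b') (if b' = b then c else 0) t := by
    intro b'
    by_cases hbb : b' = b
    · subst hbb; simpa using hb
    · simp only [hbb, if_false]
      have : (fun t => h t b') = fun _ => h 0 b' := funext fun t => hne b' hbb t
      rw [this]; exact hasDerivAt_const _ _
  have h1 := hasDerivAt_wsum e (fun S => bondSpin e S b) h _ t hh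
  have h2 := hasDerivAt_wsum e (fun _ => 1) h _ t hh
  have hz := (Zf_pos e (h t)).ne'
  refine (h1.div h2 hz).congr_deriv ?_
  -- Only the field at `b` moves, and `S_b ^ 2 = 1` turns the differentiated numerator into `c Z`.
  have e1 : (wsum e (h t) fun S => bondSpin e S b *
      ∑ b', (if b' = b then c else 0) * bondSpin e S b') = c * Zf e (h t) := by
    simp only [ite_mul, zero_mul, Finset.sum_ite_eq', Finset.mem_univ, if_true, Zf, wsum,
      Finset.mul_sum]
    refine Finset.sum_congr rfl fun S _ => ?_
    linear_combination (c * weight e (h t) S) * bondSpin_mul_self e S b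
  have e2 : (wsum e (h t) fun S => 1 *
      ∑ b', (if b' = b then c else 0) * bondSpin e S b')
        = c * wsum e (h t) (fun S => bondSpin e S b) := by
    simp only [ite_mul, zero_mul, Finset.sum_ite_eq', Finset.mem_univ, if_true, wsum,
      Finset.mul_sum]
    refine Finset.sum_congr rfl fun S _ => ?_
    ring
  rw [e1, e2, mean]
  change _ / Zf e (h t) ^ 2 = _
  have : wsum e (h t) (fun _ => 1) = Zf e (h t) := rfl
  rw [this]
  field_simp

/-! ### Gauge transformations -/

-- Bond spins are multiplicative in the configuration, so the signs given to the fields by `T` can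
-- be absorbed by relabelling `S` as `T * S`.
omit [Fintype V] [DecidableEq V] in
lemma weight_gauge (e : B → V × V) (h : B → ℝ) (S T : V → ℤˣ) :
    weight e (fun b => bondSpin e T b * h b) S = weight e h (T * S) := by
  unfold weight
  congr 1
  refine Finset.sum_congr rfl fun b _ => ?_
  rw [bondSpin_mul]; ring

lemma wsum_gauge (e : B → V × V) (h : B → ℝ) (a : (V → ℤˣ) → ℝ) (T : V → ℤˣ) :
    wsum e (fun b => bondSpin e T b * h b) (fun S => a (T * S)) = wsum e h a := by
  simp only [wsum, weight_gauge]
  exact Fintype.sum_equiv (Equiv.mulLeft T) _ _ fun S => rfl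

lemma Zf_gauge (e : B → V × V) (h : B → ℝ) (T : V → ℤˣ) :
    Zf e (fun b => bondSpin e T b * h b) = Zf e h := wsum_gauge e h (fun _ => 1) T

lemma mean_gauge (e : B → V × V) (h : B → ℝ) (T : V → ℤˣ) (b : B) :
    mean e (fun b => bondSpin e T b * h b) b = bondSpin e T b * mean e h b := by
  rw [mean, mean, Zf_gauge, ← wsum_gauge e h _ T]
  simp only [bondSpin_mul, wsum, ← mul_div_assoc, Finset.mul_sum]
  congr 1
  refine Finset.sum_congr rfl fun S _ => ?_
  linear_combination (-(bondSpin e S b * weight e (fun b => bondSpin e T b * h b) S)) *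
    bondSpin_mul_self e T b

end GibbsState

/-! ### The Nishimori line: gauge averaging, Nishimori identity, monotonicity in the couplings. -/

section NishimoriLine

variable {V B : Type} [Fintype V] [DecidableEq V] [Fintype B]

/-- The local fields on the Nishimori line. -/
def nlField (x g : B → ℝ) (b : B) : ℝ := x b ^ 2 + x b * g b

/-- The pressure on the Nishimori line in terms of standard Gaussians. -/
def nlP (e : B → V × V) (x : B → ℝ) : ℝ := ∫ g, Real.log (Zf e (nlField x g)) ∂(stdG B)

/-- The quenched bond expectation on the Nishimori line in terms of standard Gaussians. -/
def nlM (e : B → V × V) (x : B → ℝ) (b : B) : ℝ := ∫ g, mean e (nlField x g) b ∂(stdG B)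

omit [Fintype B] in
lemma measurable_nlField (x : B → ℝ) : Measurable fun g => nlField x g := by
  unfold nlField; fun_prop

omit [Fintype B] in
lemma nlField_eq (x g : B → ℝ) : nlField x g = fun b => x b * (x b + g b) := by
  ext b; simp [nlField]; ring

lemma disorder_eq_map (a σ : B → ℝ) :
    disorder a σ = (stdG B).map (fun g b => a b + σ b * g b) := (stdG_map_affine a σ).symm

-- On the line `β_b J_b = (x_b / σ)(σ x_b + σ g_b) = x_b ^ 2 + x_b g_b`, free of `σ`.
omit [Fintype V] [DecidableEq V] in
lemma exp_potential_nl (e : B → V × V) (σ : ℝ) (hσ : 0 < σ) (x g : B → ℝ) (S : V → ℤˣ) :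
    Real.exp (potential e (fun b => x b / σ) (fun b => σ * x b + σ * g b) S)
      = weight e (nlField x g) S := by
  unfold potential weight nlField
  congr 1
  refine Finset.sum_congr rfl fun b _ => ?_
  field_simp

lemma partitionFn_nl (e : B → V × V) (σ : ℝ) (hσ : 0 < σ) (x g : B → ℝ) :
    partitionFn e (fun b => x b / σ) (fun b => σ * x b + σ * g b) = Zf e (nlField x g) := by
  simp [partitionFn, exp_potential_nl e σ hσ, Zf, wsum]

lemma gibbs_nl (e : B → V × V) (σ : ℝ) (hσ : 0 < σ) (x g : B → ℝ) (f : (V → ℤˣ) → ℝ) :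
    gibbs e (fun b => x b / σ) (fun b => σ * x b + σ * g b) f
      = wsum e (nlField x g) f / Zf e (nlField x g) := by
  simp [gibbs, exp_potential_nl e σ hσ, partitionFn_nl e σ hσ, wsum]

omit [Fintype V] [DecidableEq V] in
lemma continuous_potential (e : B → V × V) (β : B → ℝ) (S : V → ℤˣ) :
    Continuous fun J => potential e β J S := by
  unfold potential; fun_prop

lemma continuous_partitionFn (e : B → V × V) (β : B → ℝ) :
    Continuous fun J => partitionFn e β J := by
  have := continuous_potential e β
  unfold partitionFn; fun_prop

lemma partitionFn_pos (e : B → V × V) (β J : B → ℝ) : 0 < partitionFn e β J :=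
  Finset.sum_pos (fun _ _ => Real.exp_pos _) Finset.univ_nonempty

lemma nlPressure_eq (e : B → V × V) (σ : ℝ) (hσ : 0 < σ) (x : B → ℝ) :
    nlPressure e (fun _ => σ) x = nlP e x := by
  rw [nlPressure, pressure, disorder_eq_map,
    integral_map (Measurable.aemeasurable (by fun_prop))]
  · simp only [partitionFn_nl e σ hσ, nlP]
  · exact ((continuous_partitionFn e _).log
      fun J => (partitionFn_pos e _ J).ne').aestronglyMeasurable

lemma nlQuenched_eq (e : B → V × V) (σ : ℝ) (hσ : 0 < σ) (x : B → ℝ) (f : (V → ℤˣ) → ℝ) :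
    nlQuenched e (fun _ => σ) x f
      = ∫ g, wsum e (nlField x g) f / Zf e (nlField x g) ∂(stdG B) := by
  rw [nlQuenched, quenched, disorder_eq_map,
    integral_map (Measurable.aemeasurable (by fun_prop))]
  · simp only [gibbs_nl e σ hσ]
  · have := continuous_potential e (fun b => x b / σ)
    refine Continuous.aestronglyMeasurable ?_
    unfold gibbs
    exact Continuous.div (by fun_prop) (continuous_partitionFn e _)
      fun J => (partitionFn_pos e _ J).ne'

lemma nlQuenched_bondSpin (e : B → V × V) (σ : ℝ) (hσ : 0 < σ) (x : B → ℝ) (b : B) :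
    nlQuenched e (fun _ => σ) x (fun S => bondSpin e S b) = nlM e x b :=
  nlQuenched_eq e σ hσ x _

lemma integrable_mean (e : B → V × V) (x : B → ℝ) (b : B) :
    Integrable (fun g => mean e (nlField x g) b) (stdG B) :=
  Integrable.of_bound ((continuous_mean e b).measurable.comp
    (measurable_nlField x)).aestronglyMeasurable 1 (ae_of_all _ fun _ => abs_mean_le _ _ _)

lemma nlQuenched_average (e : B → V × V) (σ : ℝ) (hσ : 0 < σ) (x : B → ℝ) (C : Finset B) (r : ℝ) :
    nlQuenched e (fun _ => σ) x (fun S => r * ∑ b ∈ C, bondSpin e S b)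
      = r * ∑ b ∈ C, nlM e x b := by
  rw [nlQuenched_eq e σ hσ]
  simp only [nlM]
  rw [← integral_finsetSum _ fun b _ => integrable_mean e x b, ← integral_const_mul]
  congr 1
  ext g
  simp only [mean, wsum, ← Finset.sum_div, ← mul_div_assoc]
  congr 1
  rw [Finset.sum_comm, Finset.mul_sum]
  refine Finset.sum_congr rfl fun S _ => ?_
  rw [← Finset.sum_mul]; ring

lemma abs_nlM_le (e : B → V × V) (x : B → ℝ) (b : B) : |nlM e x b| ≤ 1 := by
  have := norm_integral_le_of_norm_le_const (μ := stdG B) (f := fun g => mean e (nlField x g) b)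
    (C := 1) (ae_of_all _ fun g => abs_mean_le e (nlField x g) b)
  simpa [nlM] using this

/-- The normalization of the gauge-symmetric representation of the Nishimori line. -/
def nlNorm (x : B → ℝ) : ℝ := Real.exp (-∑ b, x b ^ 2 / 2)

/-- The squared unnormalized bond expectation divided by the partition function. -/
def sqOver (e : B → V × V) (h : B → ℝ) (b : B) : ℝ :=
  wsum e h (fun S => bondSpin e S b) ^ 2 / Zf e h

/-- The field `x_b (x_b + g_b)` is the centred field `x_b g_b` with the disorder shifted by `x_b`.
The Cameron-Martin density of this shift is, up to `nlNorm x`, the Boltzmann weight of the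
configuration `S = 1`. -/
lemma integral_nl_shift (x : B → ℝ) (F : (B → ℝ) → ℝ) :
    ∫ g, F (nlField x g) ∂(stdG B)
      = nlNorm x * ∫ g, Real.exp (∑ b, x b * g b) * F (fun b => x b * g b) ∂(stdG B) := by
  have h := integral_stdG_shift x (fun g => F (fun b => x b * g b))
  simp_rw [nlField_eq]
  rw [h, ← integral_const_mul]
  congr 1
  ext g
  rw [Finset.sum_sub_distrib, sub_eq_add_neg, Real.exp_add, nlNorm]
  ring

lemma integrable_exp_linear (x : B → ℝ) :
    Integrable (fun g => Real.exp (∑ b, x b * g b)) (stdG B) := by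
  simp_rw [Real.exp_sum]
  exact Integrable.fintype_prod (f := fun b z => Real.exp (x b * z))
    fun b => integrable_exp_mul_gaussianReal (x b)

omit [Fintype V] [DecidableEq V] in
lemma integrable_weight (e : B → V × V) (x : B → ℝ) (S : V → ℤˣ) :
    Integrable (fun g => weight e (fun b => x b * g b) S) (stdG B) := by
  refine (integrable_exp_linear fun b => x b * bondSpin e S b).congr (ae_of_all _ fun g => ?_)
  simp only [weight]
  congr 1
  exact Finset.sum_congr rfl fun b _ => by ring

-- The Laplace transform of the Gaussian sees the bond spins only through `S_b ^ 2 = 1`, so all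
-- configurations have the same mean weight.
omit [Fintype V] [DecidableEq V] in
lemma integral_weight (e : B → V × V) (x : B → ℝ) (S : V → ℤˣ) :
    ∫ g, weight e (fun b => x b * g b) S ∂(stdG B) = (nlNorm x)⁻¹ := by
  have h := integral_stdG_shift (fun b => x b * bondSpin e S b) (fun _ => 1)
  simp only [integral_const, probReal_univ, smul_eq_mul, mul_one] at h
  have h2 : ∀ g : B → ℝ, Real.exp (∑ b, (x b * bondSpin e S b * g b - (x b * bondSpin e S b) ^ 2 / 2))
      = nlNorm x * weight e (fun b => x b * g b) S := by
    intro g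
    rw [nlNorm, weight, ← Real.exp_add, ← Finset.sum_neg_distrib, ← Finset.sum_add_distrib]
    congr 1
    refine Finset.sum_congr rfl fun b _ => ?_
    linear_combination (-(x b ^ 2 / 2)) * bondSpin_mul_self e S b
  simp_rw [h2] at h
  rw [integral_const_mul] at h
  exact (inv_eq_of_mul_eq_one_right h.symm).symm

lemma integrable_wsum (e : B → V × V) (x : B → ℝ) (a : (V → ℤˣ) → ℝ) :
    Integrable (fun g => wsum e (fun b => x b * g b) a) (stdG B) :=
  integrable_finsetSum _ fun S _ => (integrable_weight e x S).const_mul _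

/-- Averages on the Nishimori line, averaged over the gauge group. -/
lemma card_mul_integral_nl (e : B → V × V) (x : B → ℝ) (F : (B → ℝ) → ℝ) :
    Fintype.card (V → ℤˣ) * ∫ g, F (nlField x g) ∂(stdG B)
      = nlNorm x * ∑ S, ∫ g, weight e (fun b => x b * g b) S *
          F (fun b => bondSpin e S b * (x b * g b)) ∂(stdG B) := by
  rw [Finset.mul_sum]
  have h : ∀ S : V → ℤˣ, nlNorm x * ∫ g, weight e (fun b => x b * g b) S *
          F (fun b => bondSpin e S b * (x b * g b)) ∂(stdG B) = ∫ g, F (nlField x g) ∂(stdG B) := by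
    intro S
    rw [integral_nl_shift]
    congr 1
    have hs : ∀ b, bondSpin e S b ≠ 0 := fun b hb => by
      have := abs_bondSpin e S b; simp [hb] at this
    have hemb : MeasurableEmbedding (fun (g : B → ℝ) b => bondSpin e S b * g b) :=
      (MeasurableEquiv.piCongrRight fun b => MeasurableEquiv.mulLeft₀ _ (hs b)).measurableEmbedding
    -- The substitution `g_b ↦ S_b g_b` turns the weight of the configuration `1` into that of `S`;
    -- each summand thus equals the integral on the left.
    rw [← (measurePreserving_sign (fun b => bondSpin e S b) fun b => by
      rw [pow_two, bondSpin_mul_self]).integral_comp hemb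
        (fun g => Real.exp (∑ b, x b * g b) * F (fun b => x b * g b))]
    congr 1
    ext g
    congr 1
    · unfold weight
      congr 1
      exact Finset.sum_congr rfl fun b _ => by ring
    · congr 1
      ext b
      ring
  rw [Finset.sum_congr rfl fun S _ => h S, Finset.sum_const, Finset.card_univ, nsmul_eq_mul]

lemma continuous_sqOver (e : B → V × V) (b : B) : Continuous fun h => sqOver e h b :=
  ((continuous_wsum e _).pow 2).div (continuous_Zf e) fun h => (Zf_pos e h).ne'

lemma sqOver_nonneg (e : B → V × V) (h : B → ℝ) (b : B) : 0 ≤ sqOver e h b :=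
  div_nonneg (sq_nonneg _) (Zf_pos e h).le

lemma sqOver_le (e : B → V × V) (h : B → ℝ) (b : B) : sqOver e h b ≤ Zf e h := by
  rw [sqOver, div_le_iff₀ (Zf_pos e h), ← pow_two, sq_le_sq]
  exact (abs_wsum_le e h _ fun S => (abs_bondSpin e S b).le).trans (le_abs_self _)

lemma integrable_sqOver (e : B → V × V) (x : B → ℝ) (b : B) :
    Integrable (fun g => sqOver e (fun b => x b * g b) b) (stdG B) := by
  refine (integrable_wsum e x fun _ => 1).mono'
    ((continuous_sqOver e b).comp (by fun_prop)).aestronglyMeasurable (ae_of_all _ fun g => ?_)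
  rw [Real.norm_eq_abs, abs_of_nonneg (sqOver_nonneg _ _ _)]
  exact sqOver_le _ _ _

/-- The gauge transformation by `S` multiplies `⟨S_b⟩` by `S_b`; summing this against the weights of
`S` produces `A * (A / Z)`, with `A` the unnormalized expectation. -/
lemma card_mul_nlM (e : B → V × V) (x : B → ℝ) (b : B) :
    Fintype.card (V → ℤˣ) * nlM e x b
      = nlNorm x * ∫ g, sqOver e (fun b => x b * g b) b ∂(stdG B) := by
  rw [nlM, card_mul_integral_nl e x (fun h => mean e h b), ← integral_finsetSum]
  · congr 2
    ext g
    simp only [mean_gauge]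
    have : wsum e (fun b => x b * g b) (fun S => bondSpin e S b) * mean e (fun b => x b * g b) b
        = sqOver e (fun b => x b * g b) b := by
      rw [mean, sqOver]; ring
    rw [← this, wsum, Finset.sum_mul]
    exact Finset.sum_congr rfl fun S _ => by ring
  · intro S _
    refine (integrable_weight e x S).mul_bdd (c := 1) ?_ (ae_of_all _ fun g => abs_mean_le _ _ _)
    exact ((continuous_mean e b).comp (by fun_prop)).aestronglyMeasurable

/-- The Nishimori identity. -/
lemma integral_mean_sq (e : B → V × V) (x : B → ℝ) (b : B) :
    ∫ g, mean e (nlField x g) b ^ 2 ∂(stdG B) = nlM e x b := by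
  have hc : (Fintype.card (V → ℤˣ) : ℝ) ≠ 0 := by exact_mod_cast Fintype.card_ne_zero
  refine mul_left_cancel₀ hc ?_
  rw [card_mul_nlM, card_mul_integral_nl e x (fun h => mean e h b ^ 2), ← integral_finsetSum]
  · congr 2
    ext g
    -- The square is gauge invariant, so the weights sum to `Z` and `Z * (A / Z) ^ 2 = A ^ 2 / Z`,
    -- the integrand found for `[⟨S_b⟩]`.
    simp only [mean_gauge, mul_pow, pow_two (bondSpin _ _ _), bondSpin_mul_self, one_mul]
    rw [← Finset.sum_mul]
    have hz := (Zf_pos e (fun b => x b * g b)).ne'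
    have : ∑ S, weight e (fun b => x b * g b) S = Zf e (fun b => x b * g b) := by simp [Zf, wsum]
    rw [this, mean, sqOver]
    field_simp
  · intro S _
    refine (integrable_weight e x S).mul_bdd (c := 1) ?_ (ae_of_all _ fun g => ?_)
    · exact (((continuous_mean e b).pow 2).comp (by fun_prop)).aestronglyMeasurable
    · rw [norm_pow]
      exact pow_le_one₀ (norm_nonneg _) (abs_mean_le _ _ _)

lemma nlM_nonneg (e : B → V × V) (x : B → ℝ) (b : B) : 0 ≤ nlM e x b := by
  rw [← integral_mean_sq]
  exact integral_nonneg fun g => sq_nonneg _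

lemma nlM_le_one (e : B → V × V) (x : B → ℝ) (b : B) : nlM e x b ≤ 1 :=
  (le_abs_self _).trans (abs_nlM_le e x b)

omit [Fintype V] [DecidableEq V] in
lemma weight_add (e : B → V × V) (h h' : B → ℝ) (S : V → ℤˣ) :
    weight e (fun b => h b + h' b) S = weight e h S * weight e h' S := by
  unfold weight
  rw [← Real.exp_add, ← Finset.sum_add_distrib]
  congr 1
  exact Finset.sum_congr rfl fun b _ => by ring

/-- Adding independent centred fields multiplies every unnormalized sum by the same constant on
average, a martingale property. -/
lemma integral_wsum_add (e : B → V × V) (w h : B → ℝ) (a : (V → ℤˣ) → ℝ) :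
    ∫ g, wsum e (fun b => h b + w b * g b) a ∂(stdG B) = (nlNorm w)⁻¹ * wsum e h a := by
  simp only [wsum, weight_add e h (fun b => w b * _)]
  rw [integral_finsetSum, Finset.mul_sum]
  · refine Finset.sum_congr rfl fun S _ => ?_
    rw [integral_const_mul, integral_const_mul, integral_weight]
    ring
  · exact fun S _ => ((integrable_weight e w S).const_mul _).const_mul _

lemma integrable_wsum_add (e : B → V × V) (w h : B → ℝ) (a : (V → ℤˣ) → ℝ) :
    Integrable (fun g => wsum e (fun b => h b + w b * g b) a) (stdG B) := by
  simp only [wsum, weight_add e h (fun b => w b * _)]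
  exact integrable_finsetSum _ fun S _ => ((integrable_weight e w S).const_mul _).const_mul _

/-- The tangent plane of the convex function `A ^ 2 / Z` along the ray `A = r Z`. It replaces
Jensen's inequality in the monotonicity proof. -/
lemma tangent_le_sqOver (e : B → V × V) (h : B → ℝ) (b : B) (r : ℝ) :
    2 * r * wsum e h (fun S => bondSpin e S b) - r ^ 2 * Zf e h ≤ sqOver e h b := by
  rw [sqOver, le_div_iff₀ (Zf_pos e h)]
  nlinarith [sq_nonneg (wsum e h (fun S => bondSpin e S b) - r * Zf e h)]

/-- Monotonicity of the bond expectations in the couplings on the Nishimori line. -/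
theorem nlM_mono (e : B → V × V) (x y : B → ℝ) (hx : ∀ b, 0 ≤ x b) (hxy : ∀ b, x b ≤ y b) (b : B) :
    nlM e x b ≤ nlM e y b := by
  have hc : (0 : ℝ) < Fintype.card (V → ℤˣ) := by exact_mod_cast Fintype.card_pos
  refine le_of_mul_le_mul_left ?_ hc
  rw [card_mul_nlM, card_mul_nlM]
  -- Chosen so that the fields `y_b g_b` have the law of `x_b g_b + w_b g'_b` with `g'` independent
  -- of `g`.
  set w : B → ℝ := fun b => √(y b ^ 2 - x b ^ 2) with hw
  have hsq : ∀ b, x b ^ 2 + w b ^ 2 = y b ^ 2 := by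
    intro b
    rw [hw, Real.sq_sqrt (sub_nonneg.2 (pow_le_pow_left₀ (hx b) (hxy b) 2))]
    ring
  have hmap := stdG_map_add x w y hsq
  have hnorm : nlNorm y = nlNorm x * nlNorm w := by
    rw [nlNorm, nlNorm, nlNorm, ← Real.exp_add, ← neg_add, ← Finset.sum_add_distrib]
    congr 2
    refine Finset.sum_congr rfl fun b _ => ?_
    rw [← hsq b]; ring
  have hwpos : 0 < nlNorm w := Real.exp_pos _
  have hxpos : 0 < nlNorm x := Real.exp_pos _
  have hmeas : Measurable (fun (p : (B → ℝ) × (B → ℝ)) b => x b * p.1 b + w b * p.2 b) := by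
    fun_prop
  have hmeasy : Measurable (fun (g : B → ℝ) b => y b * g b) := by fun_prop
  have transfer : ∀ F : (B → ℝ) → ℝ, Continuous F →
      Integrable (fun g => F (fun b => y b * g b)) (stdG B) →
      Integrable (fun p : (B → ℝ) × (B → ℝ) => F (fun b => x b * p.1 b + w b * p.2 b))
        ((stdG B).prod (stdG B)) := by
    intro F hF hi
    have h1 : Integrable F ((stdG B).map (fun g b => y b * g b)) :=
      (integrable_map_measure hF.aestronglyMeasurable hmeasy.aemeasurable).2 hi
    rw [← hmap] at h1
    exact (integrable_map_measure hF.aestronglyMeasurable hmeas.aemeasurable).1 h1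
  have e1 : ∫ g, sqOver e (fun b => y b * g b) b ∂(stdG B)
      = ∫ p, sqOver e (fun b => x b * p.1 b + w b * p.2 b) b ∂((stdG B).prod (stdG B)) := by
    rw [← integral_map (f := fun h => sqOver e h b) hmeasy.aemeasurable
      (continuous_sqOver e b).aestronglyMeasurable, ← hmap,
      integral_map hmeas.aemeasurable (continuous_sqOver e b).aestronglyMeasurable]
  -- The tangent plane is taken at the state before the fields `w` are added; its slope depends on
  -- the first vector only.
  set r : (B → ℝ) → ℝ := fun g => mean e (fun b => x b * g b) b with hr
  have hrc : Continuous r := (continuous_mean e b).comp (by fun_prop)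
  have hr1 : ∀ g, |r g| ≤ 1 := fun g => abs_mean_le _ _ _
  have i1 : Integrable (fun p : (B → ℝ) × (B → ℝ) => 2 * r p.1 *
      wsum e (fun b => x b * p.1 b + w b * p.2 b) (fun S => bondSpin e S b))
        ((stdG B).prod (stdG B)) := by
    refine (transfer _ (continuous_wsum e _) (integrable_wsum e y _)).bdd_mul (c := 2)
      (Continuous.aestronglyMeasurable (by fun_prop)) (ae_of_all _ fun p => ?_)
    rw [Real.norm_eq_abs, abs_mul, abs_two]
    linarith [hr1 p.1]
  have i2 : Integrable (fun p : (B → ℝ) × (B → ℝ) => r p.1 ^ 2 *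
      Zf e (fun b => x b * p.1 b + w b * p.2 b)) ((stdG B).prod (stdG B)) := by
    refine (transfer _ (continuous_Zf e) (integrable_wsum e y _)).bdd_mul (c := 1)
      (Continuous.aestronglyMeasurable (by fun_prop)) (ae_of_all _ fun p => ?_)
    rw [norm_pow]
    exact pow_le_one₀ (norm_nonneg _) (hr1 p.1)
  -- Integrating out the second vector replaces `A` and `Z` by multiples of their values at the
  -- point of tangency, where the tangent plane equals `A ^ 2 / Z`.
  have e2 : ∫ p : (B → ℝ) × (B → ℝ), (2 * r p.1 *
      wsum e (fun b => x b * p.1 b + w b * p.2 b) (fun S => bondSpin e S b) -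
      r p.1 ^ 2 * Zf e (fun b => x b * p.1 b + w b * p.2 b)) ∂((stdG B).prod (stdG B))
      = (nlNorm w)⁻¹ * ∫ g, sqOver e (fun b => x b * g b) b ∂(stdG B) := by
    refine (integral_prod _ (i1.sub i2)).trans ?_
    rw [← integral_const_mul]
    refine integral_congr_ae (ae_of_all _ fun g => ?_)
    change ∫ y, (2 * r g * wsum e (fun b => x b * g b + w b * y b) (fun S => bondSpin e S b) -
      r g ^ 2 * wsum e (fun b => x b * g b + w b * y b) fun _ => 1) ∂(stdG B)
      = (nlNorm w)⁻¹ * sqOver e (fun b => x b * g b) b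
    rw [integral_sub ((integrable_wsum_add e w _ _).const_mul _)
      ((integrable_wsum_add e w _ _).const_mul _), integral_const_mul, integral_const_mul,
      integral_wsum_add, integral_wsum_add]
    have hz := (Zf_pos e (fun b => x b * g b)).ne'
    change 2 * r g * _ - r g ^ 2 * (_ * Zf e (fun b => x b * g b)) = _
    rw [hr, sqOver]
    simp only [mean]
    field_simp
    ring
  have e3 := integral_mono (i1.sub i2) (transfer _ (continuous_sqOver e b) (integrable_sqOver e y b))
    fun p => tangent_le_sqOver e _ b (r p.1)
  have e4 : (nlNorm w)⁻¹ * ∫ g, sqOver e (fun b => x b * g b) b ∂(stdG B)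
      ≤ ∫ g, sqOver e (fun b => y b * g b) b ∂(stdG B) := by
    rw [e1, ← e2]; exact e3
  rw [hnorm, mul_assoc]
  refine mul_le_mul_of_nonneg_left ?_ hxpos.le
  calc _ = nlNorm w * ((nlNorm w)⁻¹ * ∫ g, sqOver e (fun b => x b * g b) b ∂(stdG B)) := by
        field_simp
    _ ≤ _ := mul_le_mul_of_nonneg_left e4 hwpos.le

end NishimoriLine

/-! ### Derivatives of the pressure along the Nishimori line. -/

section Calculus

variable {V B : Type} [Fintype V] [DecidableEq V] [Fintype B]

/-- Integration by parts gives `x_b (1 - [⟨S_b⟩ ^ 2])`, and the Nishimori identity removes the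
square. -/
lemma integral_mul_mean (e : B → V × V) (x : B → ℝ) (b : B) :
    ∫ g, g b * mean e (nlField x g) b ∂(stdG B) = x b * (1 - nlM e x b) := by
  classical
  have hm : Measurable fun g => mean e (nlField x g) b :=
    (continuous_mean e b).measurable.comp (measurable_nlField x)
  have hsq : ∀ g, mean e (nlField x g) b ^ 2 ≤ 1 := fun g =>
    (sq_le_one_iff_abs_le_one _).2 (abs_mean_le _ _ _)
  rw [integral_mul_stdG b (fun g => mean e (nlField x g) b)
    (fun g => x b * (1 - mean e (nlField x g) b ^ 2)) ?_ hm (by fun_prop) (1 + |x b|) ?_ ?_]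
  · rw [integral_const_mul, integral_sub (integrable_const _), integral_mean_sq]
    · simp
    · exact Integrable.of_bound (hm.pow_const 2).aestronglyMeasurable 1 (ae_of_all _ fun g => by
        rw [Real.norm_eq_abs, abs_of_nonneg (sq_nonneg _)]; exact hsq g)
  · intro g z
    refine hasDerivAt_mean e b (fun z => nlField x (Function.update g b z)) (x b) z ?_ ?_
    · simp only [nlField, Function.update_self]
      simpa using ((hasDerivAt_id z).const_mul (x b)).const_add (x b ^ 2)
    · intro b' hb' t
      simp [nlField, Function.update_of_ne hb']
  · intro g
    linarith [abs_mean_le e (nlField x g) b, abs_nonneg (x b)]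
  · intro g
    rw [abs_mul, abs_of_nonneg (sub_nonneg.2 (hsq g))]
    nlinarith [abs_nonneg (x b), sq_nonneg (mean e (nlField x g) b)]

lemma integrable_log_Zf (e : B → V × V) (x : B → ℝ) :
    Integrable (fun g => Real.log (Zf e (nlField x g))) (stdG B) := by
  have hm : Measurable fun g => Real.log (Zf e (nlField x g)) :=
    ((continuous_Zf e).measurable.comp (measurable_nlField x)).log
  refine Integrable.mono' (g := fun g => Real.log (Fintype.card (V → ℤˣ)) + ∑ b, |nlField x g b|)
    ?_ hm.aestronglyMeasurable (ae_of_all _ fun g => abs_log_Zf_le e _)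
  refine (integrable_const _).add (integrable_finsetSum _ fun b _ => Integrable.abs ?_)
  exact (integrable_const _).add ((integrable_stdG_eval b).const_mul _)

/-- The derivative of the pressure in the couplings on the Nishimori line. -/
theorem hasDerivAt_nlP (e : B → V × V) (a c : B → ℝ) (s : ℝ) :
    HasDerivAt (fun s => nlP e (fun b => a b + s * c b))
      (∑ b, c b * (a b + s * c b) * (1 + nlM e (fun b => a b + s * c b) b)) s := by
  have hm : ∀ x : B → ℝ, Measurable fun g => Real.log (Zf e (nlField x g)) := fun x =>
    ((continuous_Zf e).measurable.comp (measurable_nlField x)).log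
  have hmm : ∀ (x : B → ℝ) b, Measurable fun g => mean e (nlField x g) b := fun x b =>
    (continuous_mean e b).measurable.comp (measurable_nlField x)
  have hi : ∀ b, Integrable (fun g => (2 * (a b + s * c b) * c b) *
      mean e (nlField (fun b => a b + s * c b) g) b +
      c b * (g b * mean e (nlField (fun b => a b + s * c b) g) b)) (stdG B) := fun b =>
    ((integrable_mean e _ b).const_mul _).add (Integrable.const_mul
      ((integrable_stdG_eval b).mul_bdd (hmm _ b).aestronglyMeasurable
        (ae_of_all _ fun g => abs_mean_le _ _ _)) _)
  have key := hasDerivAt_integral_of_dominated_loc_of_deriv_le (μ := stdG B)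
    (F := fun s g => Real.log (Zf e (nlField (fun b => a b + s * c b) g)))
    (F' := fun s g => ∑ b, (2 * (a b + s * c b) * c b + c b * g b) *
      mean e (nlField (fun b => a b + s * c b) g) b)
    (x₀ := s) (s := Metric.ball s 1)
    -- Valid for parameters within distance `1` of `s`, since Gibbs means of bond spins are at most
    -- `1` in absolute value.
    (bound := fun g => ∑ b, (2 * (|a b| + (|s| + 1) * |c b|) * |c b| + |c b| * |g b|))
    (Metric.ball_mem_nhds s one_pos)
    (Eventually.of_forall fun s => (hm _).aestronglyMeasurable) (integrable_log_Zf e _)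
    ?_ ?_ ?_ ?_
  · refine key.2.congr_deriv ?_
    have : ∀ g : B → ℝ, ∑ b, (2 * (a b + s * c b) * c b + c b * g b) *
        mean e (nlField (fun b => a b + s * c b) g) b
        = ∑ b, ((2 * (a b + s * c b) * c b) * mean e (nlField (fun b => a b + s * c b) g) b +
          c b * (g b * mean e (nlField (fun b => a b + s * c b) g) b)) := fun g =>
      Finset.sum_congr rfl fun b _ => by ring
    simp_rw [this]
    rw [integral_finsetSum _ fun b _ => hi b]
    refine Finset.sum_congr rfl fun b _ => ?_
    -- With `x_b = a_b + s c_b`, the deterministic part of the field gives `2 x_b [⟨S_b⟩]` and the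
    -- Gaussian part `x_b (1 - [⟨S_b⟩])`; together `x_b (1 + [⟨S_b⟩])`.
    rw [integral_add ((integrable_mean e _ b).const_mul _) (Integrable.const_mul
      ((integrable_stdG_eval b).mul_bdd (hmm _ b).aestronglyMeasurable
        (ae_of_all _ fun g => abs_mean_le _ _ _)) _), integral_const_mul, integral_const_mul,
      integral_mul_mean]
    change 2 * (a b + s * c b) * c b * nlM e (fun b => a b + s * c b) b + _ = _
    ring
  · exact (Finset.measurable_sum _ fun b _ =>
      (Measurable.mul (by fun_prop) (hmm _ b))).aestronglyMeasurable
  · refine ae_of_all _ fun g t ht => ?_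
    refine (norm_sum_le _ _).trans (Finset.sum_le_sum fun b _ => ?_)
    rw [norm_mul]
    have ht' : |t| ≤ |s| + 1 := by
      have h1 : |t - s| < 1 := by simpa [Real.dist_eq] using ht
      have h2 := abs_add_le (t - s) s
      rw [sub_add_cancel] at h2
      linarith
    have h3 : |a b + t * c b| ≤ |a b| + (|s| + 1) * |c b| := by
      refine (abs_add_le _ _).trans ?_
      rw [abs_mul]
      gcongr
    calc _ ≤ ‖2 * (a b + t * c b) * c b + c b * g b‖ * 1 :=
          mul_le_mul_of_nonneg_left (abs_mean_le _ _ _) (norm_nonneg _)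
      _ ≤ |2 * (a b + t * c b) * c b| + |c b * g b| := by
          rw [mul_one]; exact abs_add_le _ _
      _ ≤ _ := by
          rw [abs_mul, abs_mul, abs_mul, abs_two]
          gcongr
  · refine integrable_finsetSum _ fun b _ => (integrable_const _).add ?_
    exact (integrable_stdG_eval b).abs.const_mul _
  · refine ae_of_all _ fun g t _ => ?_
    refine hasDerivAt_log_Zf e (fun t => nlField (fun b => a b + t * c b) g) _ t fun b => ?_
    have h1 : HasDerivAt (fun t => a b + t * c b) (c b) t := by
      simpa using ((hasDerivAt_id t).mul_const (c b)).const_add (a b)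
    refine ((h1.pow 2).add (h1.mul_const (g b))).congr_deriv ?_
    norm_num

/-- Couplings `r √t` on `C` and `y` elsewhere. -/
def scaled (C : Finset B) [DecidablePred (· ∈ C)] (y : B → ℝ) (r t : ℝ) (b : B) : ℝ :=
  if b ∈ C then r * √t else y b

-- The couplings are affine in `√t`, so the derivative formula applies with `s = √t`. The factor `1
-- / (2 √t)` of the chain rule cancels the `√t` in that formula.
omit [Fintype B] in
lemma scaled_eq (C : Finset B) [DecidablePred (· ∈ C)] (y : B → ℝ) (r t : ℝ) :
    scaled C y r t = fun b => (if b ∈ C then 0 else y b) + √t * (if b ∈ C then r else 0) := by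
  ext b
  by_cases hb : b ∈ C <;> simp [scaled, hb, mul_comm]

lemma continuous_nlP_scaled (e : B → V × V) (C : Finset B) [DecidablePred (· ∈ C)]
    (y : B → ℝ) (r : ℝ) : Continuous fun t => nlP e (scaled C y r t) := by
  simp_rw [scaled_eq]
  have h1 : Continuous fun s => nlP e
      (fun b => (if b ∈ C then 0 else y b) + s * (if b ∈ C then r else 0)) :=
    continuous_iff_continuousAt.2 fun s => (hasDerivAt_nlP e _ _ s).continuousAt
  exact h1.comp Real.continuous_sqrt

lemma hasDerivAt_nlP_scaled (e : B → V × V) (C : Finset B) [DecidablePred (· ∈ C)]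
    (y : B → ℝ) (r : ℝ) {t : ℝ} (ht : 0 < t) :
    HasDerivAt (fun t => nlP e (scaled C y r t))
      (r ^ 2 / 2 * ∑ b ∈ C, (1 + nlM e (scaled C y r t) b)) t := by
  have h := (hasDerivAt_nlP e (fun b => if b ∈ C then 0 else y b) (fun b => if b ∈ C then r else 0)
    (√t)).comp t (Real.hasDerivAt_sqrt ht.ne')
  have hs : √t ≠ 0 := (Real.sqrt_pos.2 ht).ne'
  simp_rw [scaled_eq]
  refine h.congr_deriv ?_
  rw [Finset.sum_mul, Finset.mul_sum, ← Finset.sum_subset (Finset.subset_univ C)]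
  · refine Finset.sum_congr rfl fun b hb => ?_
    simp only [hb, if_true]
    field_simp
    ring
  · intro b _ hb
    simp [hb]

omit [Fintype B] in
lemma scaled_nonneg (C : Finset B) [DecidablePred (· ∈ C)] (y : B → ℝ) (r t : ℝ) (hr : 0 ≤ r)
    (hy : ∀ b, 0 ≤ y b) (b : B) : 0 ≤ scaled C y r t b := by
  unfold scaled
  split_ifs
  · positivity
  · exact hy b

lemma monotone_nlM_scaled (e : B → V × V) (C : Finset B) [DecidablePred (· ∈ C)] (y : B → ℝ)
    (r : ℝ) (hr : 0 ≤ r) (hy : ∀ b, 0 ≤ y b) (b : B) :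
    Monotone fun t => nlM e (scaled C y r t) b := by
  intro t s hts
  refine nlM_mono e _ _ (scaled_nonneg C y r t hr hy) (fun b => ?_) b
  unfold scaled
  split_ifs
  · exact mul_le_mul_of_nonneg_left (Real.sqrt_le_sqrt hts) hr
  · exact le_rfl

lemma intervalIntegrable_nlM_scaled (e : B → V × V) (C : Finset B) [DecidablePred (· ∈ C)]
    (y : B → ℝ) (r : ℝ) (hr : 0 ≤ r) (hy : ∀ b, 0 ≤ y b) (b : B) (t s : ℝ) :
    IntervalIntegrable (fun t => nlM e (scaled C y r t) b) volume t s :=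
  (monotone_nlM_scaled e C y r hr hy b).intervalIntegrable

/-- As `√t` is not differentiable at `0`, the derivative is used only inside the interval, with
continuity up to the end points. -/
lemma nlP_scaled_sub (e : B → V × V) (C : Finset B) [DecidablePred (· ∈ C)] (y : B → ℝ)
    (r : ℝ) (hr : 0 ≤ r) (hy : ∀ b, 0 ≤ y b) {t s : ℝ} (ht : 0 ≤ t) (hts : t ≤ s) :
    ∫ u in t..s, r ^ 2 / 2 * ∑ b ∈ C, (1 + nlM e (scaled C y r u) b)
      = nlP e (scaled C y r s) - nlP e (scaled C y r t) := by
  refine intervalIntegral.integral_eq_sub_of_hasDerivAt_of_le hts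
    (continuous_nlP_scaled e C y r).continuousOn
    (fun u hu => hasDerivAt_nlP_scaled e C y r (ht.trans_lt hu.1)) ?_
  refine IntervalIntegrable.const_mul ?_ _
  have := IntervalIntegrable.sum (f := fun b u => 1 + nlM e (scaled C y r u) b) (μ := volume)
    (a := t) (b := s) C fun b _ =>
    (intervalIntegrable_const (c := (1 : ℝ))).add (intervalIntegrable_nlM_scaled e C y r hr hy b t s)
  simpa [Finset.sum_fn] using this

/-- Switching off the couplings on `C` changes the pressure by at most a constant times the size
of `C`. -/
lemma abs_nlP_cut_le (e : B → V × V) (C : Finset B) [DecidablePred (· ∈ C)] (x : B → ℝ) (r : ℝ)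
    (hr : ∀ b ∈ C, |x b| ≤ r) :
    |nlP e x - nlP e (fun b => if b ∈ C then 0 else x b)| ≤ 2 * r ^ 2 * C.card := by
  have h : ∀ s ∈ Set.Icc (0 : ℝ) 1, HasDerivWithinAt _ _ (Set.Icc (0 : ℝ) 1) s := fun s _ =>
    (hasDerivAt_nlP e (fun b => if b ∈ C then 0 else x b) (fun b => if b ∈ C then x b else 0)
      s).hasDerivWithinAt
  -- The couplings on `C` are scaled by `s` from `0` to `1`; each bond contributes `s x_b ^ 2 (1 +
  -- m)` to the derivative, with `0 ≤ m ≤ 1`.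
  have h2 := norm_image_sub_le_of_norm_deriv_le_segment_01' (C := 2 * r ^ 2 * C.card) h ?_
  · have e1 : (fun b => (if b ∈ C then 0 else x b) + 1 * (if b ∈ C then x b else 0)) = x := by
      ext b; by_cases hb : b ∈ C <;> simp [hb]
    have e0 : (fun b => (if b ∈ C then 0 else x b) + 0 * (if b ∈ C then x b else 0))
        = fun b => if b ∈ C then 0 else x b := by
      ext b; simp
    rw [e1, e0] at h2
    exact h2
  · intro s hs
    rw [← Finset.sum_subset (Finset.subset_univ C)]
    · refine (norm_sum_le _ _).trans ?_
      have : ∀ b ∈ C, ‖(if b ∈ C then x b else 0) * ((if b ∈ C then 0 else x b) +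
          s * (if b ∈ C then x b else 0)) * (1 + nlM e (fun b => (if b ∈ C then 0 else x b) +
          s * (if b ∈ C then x b else 0)) b)‖ ≤ 2 * r ^ 2 := by
        intro b hb
        simp only [hb, if_true, zero_add]
        set m := nlM e (fun b => (if b ∈ C then 0 else x b) + s * (if b ∈ C then x b else 0)) b
        have hm0 : 0 ≤ m := nlM_nonneg _ _ _
        have hm1 : m ≤ 1 := nlM_le_one _ _ _
        have hs0 : 0 ≤ s := hs.1
        have hs1 : s ≤ 1 := hs.2.le
        have hxr : x b ^ 2 ≤ r ^ 2 := sq_le_sq' (abs_le.1 (hr b hb)).1 (abs_le.1 (hr b hb)).2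
        rw [show x b * (s * x b) * (1 + m) = (s * (1 + m)) * x b ^ 2 by ring, Real.norm_eq_abs,
          abs_of_nonneg (by positivity)]
        exact mul_le_mul (by nlinarith) hxr (sq_nonneg _) (by norm_num)
      refine (Finset.sum_le_sum this).trans ?_
      rw [Finset.sum_const, nsmul_eq_mul, mul_comm]
    · intro b _ hb
      simp [hb]

end Calculus

/-! ### Comparison of graphs: embeddings and disjoint copies. -/

section Comparison

variable {V B V' B' : Type} [Fintype V] [DecidableEq V] [Fintype B]
  [Fintype V'] [DecidableEq V'] [Fintype B']

lemma sum_comp_injective (φ : V → V') (hφ : φ.Injective) :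
    ∃ k : ℝ, k ≠ 0 ∧ ∀ F : (V → ℤˣ) → ℝ, ∑ S' : V' → ℤˣ, F (fun v => S' (φ v)) = k * ∑ S, F S := by
  classical
  refine ⟨Fintype.card ({v' // ¬ v' ∈ Set.range φ} → ℤˣ),
    by exact_mod_cast Fintype.card_ne_zero, fun F => ?_⟩
  let E := (Equiv.piEquivPiSubtypeProd (fun v' => v' ∈ Set.range φ) (fun _ : V' => ℤˣ)).trans
    (Equiv.prodCongr (Equiv.arrowCongr (Equiv.ofInjective φ hφ).symm (Equiv.refl ℤˣ))
      (Equiv.refl _))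
  rw [Fintype.sum_equiv E (fun S' => F (fun v => S' (φ v))) (fun p => F p.1) fun S' => rfl,
    Fintype.sum_prod_type_right]
  simp

omit [Fintype V] [DecidableEq V] [Fintype V'] [DecidableEq V'] in
lemma weight_extend (e : B → V × V) (e' : B' → V' × V') (φ : V → V') (ψ : B → B')
    (hψ : ψ.Injective) (he : ∀ b, e' (ψ b) = Prod.map φ φ (e b)) (h : B → ℝ) (h' : B' → ℝ)
    (hh : ∀ b, h' (ψ b) = h b) (h0 : ∀ b' ∉ Set.range ψ, h' b' = 0) (S' : V' → ℤˣ) :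
    weight e' h' S' = weight e h (fun v => S' (φ v)) := by
  unfold weight
  congr 1
  refine (Fintype.sum_of_injective ψ hψ _ _ (fun b' hb' => by rw [h0 b' hb', zero_mul])
    fun b => ?_).symm
  simp [hh, bondSpin, he]

/-- Bonds without coupling have zero field, so the spins off the image are free and contribute the
same factor `k` to numerator and denominator. -/
lemma nlM_extend (e : B → V × V) (e' : B' → V' × V') (φ : V → V') (hφ : φ.Injective) (ψ : B → B')
    (hψ : ψ.Injective) (he : ∀ b, e' (ψ b) = Prod.map φ φ (e b)) (x : B → ℝ) (x' : B' → ℝ)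
    (hx : ∀ b, x' (ψ b) = x b) (h0 : ∀ b' ∉ Set.range ψ, x' b' = 0) (b : B) :
    nlM e' x' (ψ b) = nlM e x b := by
  obtain ⟨k, hk, hF⟩ := sum_comp_injective (V := V) φ hφ
  have hw : ∀ (g : B' → ℝ) S', weight e' (nlField x' g) S'
      = weight e (nlField x fun b => g (ψ b)) (fun v => S' (φ v)) := fun g S' =>
    weight_extend e e' φ ψ hψ he _ _ (fun b => by simp [nlField, hx])
      (fun b' hb' => by simp [nlField, h0 b' hb']) S'
  have hm : ∀ g : B' → ℝ, mean e' (nlField x' g) (ψ b)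
      = mean e (nlField x fun b => g (ψ b)) b := by
    intro g
    have hb : ∀ S' : V' → ℤˣ, bondSpin e' S' (ψ b) = bondSpin e (fun v => S' (φ v)) b := fun S' => by
      simp [bondSpin, he]
    simp only [mean, Zf, wsum, hw, hb]
    rw [hF (fun S => bondSpin e S b * weight e (nlField x fun b => g (ψ b)) S),
      hF (fun S => 1 * weight e (nlField x fun b => g (ψ b)) S), mul_div_mul_left _ _ hk]
  rw [nlM, nlM, ← (measurePreserving_comp ψ hψ).map_eq, integral_map
    (measurePreserving_comp ψ hψ).measurable.aemeasurable]
  · simp only [hm]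
  · exact ((continuous_mean e b).measurable.comp (measurable_nlField x)).aestronglyMeasurable

/-- Bond expectations on the Nishimori line increase when the graph is enlarged. -/
theorem nlM_le_of_embedding (e : B → V × V) (e' : B' → V' × V') (φ : V → V') (hφ : φ.Injective)
    (ψ : B → B') (hψ : ψ.Injective) (he : ∀ b, e' (ψ b) = Prod.map φ φ (e b)) (x : B → ℝ)
    (x' : B' → ℝ) (hx : ∀ b, 0 ≤ x b) (hx' : ∀ b, 0 ≤ x' b) (hxx : ∀ b, x b ≤ x' (ψ b)) (b : B) :
    nlM e x b ≤ nlM e' x' (ψ b) := by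
  have h0 : ∀ b' ∉ Set.range ψ, Function.extend ψ x 0 b' = 0 := fun b' hb' => by
    rw [Function.extend_apply' _ _ _ (by simpa using hb')]; rfl
  rw [← nlM_extend e e' φ hφ ψ hψ he x (Function.extend ψ x 0) (fun b => hψ.extend_apply _ _ _) h0]
  have : ∀ b', 0 ≤ Function.extend ψ x 0 b' ∧ Function.extend ψ x 0 b' ≤ x' b' := by
    intro b'
    by_cases hb' : b' ∈ Set.range ψ
    · obtain ⟨c, rfl⟩ := hb'
      rw [hψ.extend_apply]
      exact ⟨hx c, hxx c⟩
    · rw [h0 b' hb']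
      exact ⟨le_rfl, hx' b'⟩
  exact nlM_mono e' _ _ (fun b' => (this b').1) (fun b' => (this b').2) _

/-- The pressure of disjoint copies of a graph. -/
theorem nlP_copies {ι : Type} [Fintype ι] (e : B → V × V)
    (e' : B' → V' × V') (φ : V × ι ≃ V') (ψ : B × ι → B') (hψ : ψ.Injective)
    (he : ∀ b i, e' (ψ (b, i)) = (φ ((e b).1, i), φ ((e b).2, i))) (x : B → ℝ) (x' : B' → ℝ)
    (hx : ∀ b i, x' (ψ (b, i)) = x b) (h0 : ∀ b' ∉ Set.range ψ, x' b' = 0) :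
    nlP e' x' = Fintype.card ι * nlP e x := by
  classical
  have hw : ∀ (g : B' → ℝ) (S' : V' → ℤˣ), weight e' (nlField x' g) S'
      = ∏ i, weight e (nlField x fun b => g (ψ (b, i))) (fun v => S' (φ (v, i))) := by
    intro g S'
    simp only [weight]
    rw [← Real.exp_sum]
    congr 1
    rw [← Fintype.sum_of_injective ψ hψ
      (fun p : B × ι => nlField x (fun b => g (ψ (b, p.2))) p.1 *
        bondSpin e (fun v => S' (φ (v, p.2))) p.1) _
      (fun b' hb' => by simp [nlField, h0 b' hb'])
      (fun p => by simp [nlField, hx, bondSpin, he]), Fintype.sum_prod_type_right]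
  have hZ : ∀ g : B' → ℝ, Zf e' (nlField x' g) = ∏ i, Zf e (nlField x fun b => g (ψ (b, i))) := by
    intro g
    simp only [Zf, wsum, hw, one_mul]
    -- A product of sums over the copies is a sum over families of configurations, that is, over
    -- configurations of the union.
    rw [Finset.prod_univ_sum, Fintype.piFinset_univ]
    let E : (V' → ℤˣ) ≃ (ι → V → ℤˣ) :=
      { toFun := fun S' i v => S' (φ (v, i))
        invFun := fun T v' => T (φ.symm v').2 (φ.symm v').1
        left_inv := fun S' => by ext v'; simp
        right_inv := fun T => by ext i v; simp }
    exact Fintype.sum_equiv E _ _ fun S' => rfl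
  have hmp : ∀ i, MeasurePreserving (fun (g : B' → ℝ) b => g (ψ (b, i))) (stdG B') (stdG B) :=
    fun i => measurePreserving_comp (fun b => ψ (b, i)) fun b c hbc => by simpa using hψ hbc
  have hlog : ∀ g : B' → ℝ, Real.log (Zf e' (nlField x' g))
      = ∑ i, Real.log (Zf e (nlField x fun b => g (ψ (b, i)))) := fun g => by
    rw [hZ, Real.log_prod fun i _ => (Zf_pos _ _).ne']
  have hint : ∀ i, ∫ g, Real.log (Zf e (nlField x fun b => g (ψ (b, i)))) ∂(stdG B') = nlP e x := by
    intro i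
    rw [nlP, ← (hmp i).map_eq, integral_map (hmp i).measurable.aemeasurable]
    exact ((continuous_Zf e).measurable.comp (measurable_nlField x)).log.aestronglyMeasurable
  rw [nlP]
  simp only [hlog]
  rw [integral_finsetSum]
  · simp [hint]
  · exact fun i _ => (hmp i).integrable_comp_of_integrable (integrable_log_Zf e x)

end Comparison

/-! ### Tori, boxes and corridors. -/

section Geometry

/-- Remainder and quotient modulo `m` of the elements of `ZMod (k * m)`. -/
def zmodSplit (k m : ℕ) [NeZero k] [NeZero m] : Fin m × Fin k ≃ ZMod (k * m) where
  toFun p := ((p.1 + m * p.2 : ℕ) : ZMod (k * m))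
  invFun z := (⟨z.val % m, Nat.mod_lt _ (NeZero.pos m)⟩,
    ⟨z.val / m, Nat.div_lt_of_lt_mul ((ZMod.val_lt z).trans_eq (mul_comm k m))⟩)
  left_inv := by
    rintro ⟨r, q⟩
    have h : (r : ℕ) + m * q < k * m := by
      calc (r : ℕ) + m * q < m + m * q := by have := r.2; omega
        _ = (q + 1) * m := by ring
        _ ≤ k * m := Nat.mul_le_mul_right m q.2
    simp only [ZMod.val_natCast_of_lt h]
    ext
    · simp [Nat.mod_eq_of_lt r.2]
    · simp [Nat.add_mul_div_left _ _ (NeZero.pos m), Nat.div_eq_of_lt r.2]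
  right_inv z := by
    simp only [Nat.mod_add_div]
    exact ZMod.natCast_zmod_val z

/-- The sites of the torus composed of `k ^ d` boxes of side `m`. -/
def siteSplit (d k m : ℕ) [NeZero k] [NeZero m] :
    (Fin d → Fin m) × (Fin d → Fin k) ≃ (Fin d → ZMod (k * m)) :=
  (Equiv.arrowProdEquivProdArrow (Fin d) (fun _ => Fin m) (fun _ => Fin k)).symm.trans
    (Equiv.piCongrRight fun _ => zmodSplit k m)

lemma siteSplit_apply (d k m : ℕ) [NeZero k] [NeZero m] (n : Fin d → Fin m) (v : Fin d → Fin k)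
    (j : Fin d) : siteSplit d k m (n, v) j = (((n j : ℕ) + m * (v j : ℕ) : ℕ) : ZMod (k * m)) := rfl

/-- Since `L` divides `N`, the corridor condition does not depend on the integer representative, so
translations can be handled in `ℤ`. -/
lemma mem_corridor_iff (d N L : ℕ) [NeZero N] (hLN : L ∣ N) (a : Fin d → ℤ) (i : Fin d) :
    ((fun j => (a j : ZMod N)), i) ∈ corridor d N L ↔ (L : ℤ) ∣ a i + 1 := by
  simp only [corridor, Finset.mem_filter, Finset.mem_univ, true_and]
  rw [← Int.natCast_dvd_natCast]
  push_cast
  rw [ZMod.val_intCast]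
  have h1 : (L : ℤ) ∣ N := Int.natCast_dvd_natCast.2 hLN
  have h2 : (L : ℤ) ∣ N * (a i / N) := h1.mul_right _
  have h3 := Int.emod_add_mul_ediv (a i) N
  constructor
  · intro h
    have := dvd_add h h2
    rwa [show a i % N + 1 + N * (a i / N) = a i + 1 by linarith] at this
  · intro h
    have := dvd_sub h h2
    rwa [show a i + 1 - N * (a i / N) = a i % N + 1 by linarith] at this

lemma siteSplit_mem_corridor (d k m L : ℕ) [NeZero k] [NeZero m] (hL : L ∣ m)
    (n : Fin d → Fin m) (v : Fin d → Fin k) (i : Fin d) :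
    (siteSplit d k m (n, v), i) ∈ corridor d (k * m) L ↔ L ∣ (n i : ℕ) + 1 := by
  have h1 : siteSplit d k m (n, v)
      = fun j => ((((n j : ℕ) + m * (v j : ℕ) : ℕ) : ℤ) : ZMod (k * m)) := by
    ext j; rw [siteSplit_apply]; push_cast; rfl
  rw [h1, mem_corridor_iff d (k * m) L (hL.mul_left k), ← Int.natCast_dvd_natCast]
  have h2 : (L : ℤ) ∣ m * (v i : ℕ) := (Int.natCast_dvd_natCast.2 hL).mul_right _
  push_cast
  constructor
  · intro h
    have := dvd_sub h h2
    rwa [show ((n i : ℕ) : ℤ) + m * (v i : ℕ) + 1 - m * (v i : ℕ) = (n i : ℕ) + 1 by ring] at this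
  · intro h
    have := dvd_add h h2
    rwa [show ((n i : ℕ) : ℤ) + 1 + m * (v i : ℕ) = (n i : ℕ) + m * (v i : ℕ) + 1 by ring] at this

lemma dvd_succ_fin_iff (m : ℕ) (r : Fin m) : m ∣ (r : ℕ) + 1 ↔ (r : ℕ) + 1 = m := by
  constructor
  · intro h
    have := Nat.le_of_dvd (Nat.succ_pos _) h
    have := r.2
    omega
  · intro h; rw [h]

/-- Sums over the corridor, box by box. -/
lemma sum_corridor (d k L : ℕ) [NeZero k] [NeZero L] (f : TorusBond d (k * L) → ℝ) :
    ∑ b ∈ corridor d (k * L) L, f b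
      = ∑ v : Fin d → Fin k, ∑ q ∈ cellCorridor d L, f (siteSplit d k L (q.1, v), q.2) := by
  rw [Finset.sum_comm, ← Finset.sum_product' (cellCorridor d L) Finset.univ
    (fun q v => f (siteSplit d k L (q.1, v), q.2))]
  symm
  refine Finset.sum_bij (fun p _ => (siteSplit d k L (p.1.1, p.2), p.1.2)) ?_ ?_ ?_ ?_
  · rintro ⟨⟨n, i⟩, v⟩ hp
    simp only [Finset.mem_product, cellCorridor, Finset.mem_filter, Finset.mem_univ, true_and,
      and_true] at hp
    rw [siteSplit_mem_corridor d k L L dvd_rfl, dvd_succ_fin_iff]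
    exact hp
  · rintro ⟨⟨n, i⟩, v⟩ _ ⟨⟨n', i'⟩, v'⟩ _ h
    simp only [Prod.mk.injEq, EmbeddingLike.apply_eq_iff_eq] at h
    obtain ⟨⟨rfl, rfl⟩, rfl⟩ := h
    rfl
  · rintro ⟨s, i⟩ hs
    obtain ⟨⟨n, v⟩, rfl⟩ := (siteSplit d k L).surjective s
    refine ⟨((n, i), v), ?_, rfl⟩
    rw [siteSplit_mem_corridor d k L L dvd_rfl, dvd_succ_fin_iff] at hs
    simpa [cellCorridor] using hs
  · intro p _; rfl

/-- For each direction `i` the bonds start on the face `n i = L - 1`, which has `L ^ (d - 1)` sites.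
-/
lemma card_cellCorridor (d L : ℕ) [NeZero L] : (cellCorridor d L).card = d * L ^ (d - 1) := by
  have hL := NeZero.pos L
  let l : Fin L := ⟨L - 1, by omega⟩
  have h : cellCorridor d L = Finset.univ.biUnion fun i : Fin d =>
      (Fintype.piFinset fun j => if j = i then {l} else Finset.univ).map
        (Function.Embedding.sectL _ i) := by
    ext ⟨n, i⟩
    simp only [cellCorridor, Finset.mem_filter, Finset.mem_univ, true_and, Finset.mem_biUnion,
      Finset.mem_map, Fintype.mem_piFinset, Function.Embedding.sectL_apply, Prod.mk.injEq]
    constructor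
    · intro hn
      refine ⟨i, n, fun j => ?_, rfl, rfl⟩
      split_ifs with hj
      · subst hj
        rw [Finset.mem_singleton, Fin.ext_iff]
        change (n j : ℕ) = L - 1
        omega
      · simp
    · rintro ⟨i', n', hn', rfl, rfl⟩
      have := hn' i'
      simp only [if_true, Finset.mem_singleton] at this
      rw [this]
      change L - 1 + 1 = L
      omega
  rw [h, Finset.card_biUnion]
  · simp only [Finset.card_map, Fintype.card_piFinset]
    have : ∀ i : Fin d, ∏ j : Fin d, (if j = i then ({l} : Finset (Fin L)) else Finset.univ).card
        = L ^ (d - 1) := by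
      intro i
      rw [← Finset.mul_prod_erase _ _ (Finset.mem_univ i)]
      rw [Finset.prod_congr rfl (g := fun _ => L) (fun j hj => by
        rw [if_neg (Finset.ne_of_mem_erase hj)]; simp)]
      simp
    simp [this]
  · intro i _ i' _ hii
    rw [Function.onFun, Finset.disjoint_left]
    rintro ⟨n, j⟩ h1 h2
    simp only [Finset.mem_map, Function.Embedding.sectL_apply, Prod.mk.injEq] at h1 h2
    obtain ⟨_, _, _, h1⟩ := h1
    obtain ⟨_, _, _, h2⟩ := h2
    exact hii (h1.trans h2.symm)

lemma card_corridor (d k L : ℕ) [NeZero k] [NeZero L] :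
    ((corridor d (k * L) L).card : ℝ) = (k : ℝ) ^ d * (d * (L : ℝ) ^ (d - 1)) := by
  have h := sum_corridor d k L fun _ => 1
  simp only [Finset.sum_const, nsmul_eq_mul, mul_one, Finset.card_univ, card_cellCorridor] at h
  rw [h]
  simp

/-- The torus cut into boxes. -/
lemma nlP_torus_cut (d k m : ℕ) [NeZero k] [NeZero m] (x : TorusBond d (k * m) → ℝ)
    (y : FreeBond d m → ℝ)
    (hx : ∀ (b : FreeBond d m) (v : Fin d → Fin k), x (siteSplit d k m (b.1.1, v), b.1.2) = y b)
    (h0 : ∀ b ∈ corridor d (k * m) m, x b = 0) :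
    nlP (torusEnds d (k * m)) x = (k : ℝ) ^ d * nlP (freeEnds d m) y := by
  rw [nlP_copies (freeEnds d m) (torusEnds d (k * m)) (siteSplit d k m)
    (fun p => (siteSplit d k m (p.1.1.1, p.2), p.1.1.2)) ?_ ?_ y x hx ?_]
  · simp
  · rintro ⟨⟨⟨n, i⟩, hb⟩, v⟩ ⟨⟨⟨n', i'⟩, hb'⟩, v'⟩ h
    simp only [Prod.mk.injEq, EmbeddingLike.apply_eq_iff_eq] at h
    obtain ⟨⟨rfl, rfl⟩, rfl⟩ := h
    rfl
  · rintro ⟨⟨n, i⟩, hb⟩ v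
    simp only [torusEnds, freeEnds, Prod.mk.injEq, true_and]
    ext j
    rw [Pi.add_apply, siteSplit_apply, siteSplit_apply]
    by_cases hj : j = i
    · subst hj
      simp only [Pi.single_eq_same, Function.update_self]
      push_cast; ring
    · simp [hj]
  · rintro ⟨s, i⟩ hs
    obtain ⟨⟨n, v⟩, rfl⟩ := (siteSplit d k m).surjective s
    refine h0 _ ?_
    rw [siteSplit_mem_corridor d k m m dvd_rfl, dvd_succ_fin_iff]
    -- A bond of the torus that is not a bond of one of the boxes starts at the last site of its box
    -- in its direction.
    by_contra hn
    have hlt : (n i : ℕ) + 1 < m := by have := (n i).2; omega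
    exact hs ⟨(⟨(n, i), hlt⟩, v), rfl⟩

/-- The bonds of the box that join adjacent boxes of side `L`. -/
def freeCorridor (d N L : ℕ) : Finset (FreeBond d N) :=
  Finset.univ.filter fun b => L ∣ (b.1.1 b.1.2 : ℕ) + 1

/-- The interpolation scheme on the box with free boundary conditions. -/
def freeInterp (d N L : ℕ) (x t : ℝ) : FreeBond d N → ℝ :=
  scaled (freeCorridor d N L) (fun _ => x) x t

lemma interp_eq (d N L : ℕ) [NeZero N] (x t : ℝ) :
    interp d N L x t = scaled (corridor d N L) (fun _ => x) x t := rfl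

lemma interp_nonneg (d N L : ℕ) [NeZero N] {x : ℝ} (hx : 0 ≤ x) (t : ℝ) (b : TorusBond d N) :
    0 ≤ interp d N L x t b := scaled_nonneg _ _ _ _ hx (fun _ => hx) b

lemma interp_one (d N L : ℕ) [NeZero N] (x : ℝ) : interp d N L x 1 = fun _ => x := by
  ext b; simp [interp]

lemma abs_interp_le (d N L : ℕ) [NeZero N] {x t : ℝ} (hx : 0 ≤ x) (ht : t ≤ 1)
    (b : TorusBond d N) : |interp d N L x t b| ≤ x := by
  rw [abs_of_nonneg (interp_nonneg d N L hx t b)]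
  unfold interp
  split_ifs
  · exact mul_le_of_le_one_right hx (Real.sqrt_le_one.2 ht)
  · exact le_rfl

lemma interp_siteSplit (d k m L : ℕ) [NeZero k] [NeZero m] (hL : L ∣ m) (x t : ℝ)
    (b : FreeBond d m) (v : Fin d → Fin k) :
    interp d (k * m) L x t (siteSplit d k m (b.1.1, v), b.1.2) = freeInterp d m L x t b := by
  unfold interp freeInterp scaled
  simp only [siteSplit_mem_corridor d k m L hL, freeCorridor, Finset.mem_filter, Finset.mem_univ,
    true_and]

/-- Cutting the torus into boxes costs a surface term. -/
lemma abs_torus_sub_free_le (d k m L : ℕ) [NeZero k] [NeZero m] (hL : L ∣ m) {x t : ℝ} (hx : 0 ≤ x)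
    (ht : t ≤ 1) :
    |nlP (torusEnds d (k * m)) (interp d (k * m) L x t)
      - (k : ℝ) ^ d * nlP (freeEnds d m) (freeInterp d m L x t)|
      ≤ 2 * x ^ 2 * ((k : ℝ) ^ d * (d * (m : ℝ) ^ (d - 1))) := by
  rw [← card_corridor, ← nlP_torus_cut d k m
    (fun b => if b ∈ corridor d (k * m) m then 0 else interp d (k * m) L x t b)
    (freeInterp d m L x t) ?_ (fun b hb => if_pos hb)]
  · exact abs_nlP_cut_le _ _ _ _ fun b _ => abs_interp_le d _ L hx ht b
  · intro b v
    rw [interp_siteSplit d k m L hL, if_neg]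
    rw [siteSplit_mem_corridor d k m m dvd_rfl, dvd_succ_fin_iff]
    exact b.2.ne

/-- The torus with vanishing corridor couplings. -/
lemma nlP_interp_zero (d k L : ℕ) [NeZero k] [NeZero L] (x : ℝ) :
    nlP (torusEnds d (k * L)) (interp d (k * L) L x 0)
      = (k : ℝ) ^ d * nlP (freeEnds d L) (fun _ => x) := by
  refine nlP_torus_cut d k L _ _ (fun b v => ?_) fun b hb => by simp [interp, hb]
  unfold interp
  rw [if_neg]
  rw [siteSplit_mem_corridor d k L L dvd_rfl, dvd_succ_fin_iff]
  exact b.2.ne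

/-- The bond correlation in the torus of side `N` at an integer point. -/
def tcorr (d N L : ℕ) [NeZero N] (x t : ℝ) (n : Fin d → ℤ) (i : Fin d) : ℝ :=
  nlM (torusEnds d N) (interp d N L x t) (fun j => (n j : ZMod N), i)

lemma torusEnds_intCast (d N : ℕ) [NeZero N] (a : Fin d → ℤ) (i : Fin d) :
    torusEnds d N (fun j => (a j : ZMod N), i)
      = (fun j => (a j : ZMod N), fun j => ((a j + (Pi.single i 1 : Fin d → ℤ) j : ℤ) : ZMod N)) := by
  simp only [torusEnds, Prod.mk.injEq, true_and]
  ext j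
  by_cases hj : j = i
  · subst hj; simp
  · simp [hj]

/-- Translation invariance by multiples of the box side, as an inequality. -/
lemma tcorr_le_of_dvd (d N L : ℕ) [NeZero N] (hLN : L ∣ N) {x : ℝ} (hx : 0 ≤ x) (t : ℝ)
    (n p : Fin d → ℤ) (hp : ∀ j, (L : ℤ) ∣ p j - n j) (i : Fin d) :
    tcorr d N L x t n i ≤ tcorr d N L x t p i := by
  let φ : (Fin d → ZMod N) → Fin d → ZMod N := fun s j => s j + ((p j - n j : ℤ) : ZMod N)
  have hφ : φ.Injective := fun s s' h => by
    ext j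
    have := congrFun h j
    simpa [φ] using this
  have h := nlM_le_of_embedding (torusEnds d N) (torusEnds d N) φ hφ (fun b => (φ b.1, b.2))
    (fun b b' h => by
      simp only [Prod.mk.injEq] at h
      exact Prod.ext (hφ h.1) h.2) (fun b => ?_) (interp d N L x t) (interp d N L x t)
    (interp_nonneg d N L hx t) (interp_nonneg d N L hx t) (fun b => le_of_eq ?_)
    (fun j => (n j : ZMod N), i)
  · refine h.trans (le_of_eq ?_)
    unfold tcorr
    congr 2
    ext j
    simp [φ]
  · simp only [torusEnds, Prod.map, Prod.mk.injEq, true_and]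
    ext j
    simp only [Pi.add_apply, φ]
    ring
  · obtain ⟨s, i'⟩ := b
    have hs : s = fun j => (((s j).val : ℤ) : ZMod N) := by
      ext j; simp
    have hs2 : φ s = fun j => (((s j).val + (p j - n j) : ℤ) : ZMod N) := by
      ext j; simp [φ]
    have m1 : (s, i') ∈ corridor d N L ↔ (L : ℤ) ∣ (s i').val + 1 := by
      conv_lhs => rw [hs]
      exact mem_corridor_iff d N L hLN _ i'
    have m2 : (φ s, i') ∈ corridor d N L ↔ (L : ℤ) ∣ (s i').val + (p i' - n i') + 1 := by
      rw [hs2]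
      exact mem_corridor_iff d N L hLN _ i'
    have : (L : ℤ) ∣ (s i').val + 1 ↔ (L : ℤ) ∣ (s i').val + (p i' - n i') + 1 := by
      rw [show ((s i').val : ℤ) + (p i' - n i') + 1 = ((s i').val + 1) + (p i' - n i') by ring]
      exact (dvd_add_left (hp i')).symm
    unfold interp
    simp only [m1, m2, this]

/-- The inequality comes from viewing a translation as an embedding of the torus into itself; the
inverse translation reverses it. -/
lemma tcorr_eq_of_dvd (d N L : ℕ) [NeZero N] (hLN : L ∣ N) {x : ℝ} (hx : 0 ≤ x) (t : ℝ)
    (n p : Fin d → ℤ) (hp : ∀ j, (L : ℤ) ∣ p j - n j) (i : Fin d) :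
    tcorr d N L x t n i = tcorr d N L x t p i :=
  le_antisymm (tcorr_le_of_dvd d N L hLN hx t n p hp i)
    (tcorr_le_of_dvd d N L hLN hx t p n (fun j => by
      rw [← neg_sub]; exact (hp j).neg_right) i)

/-- The correlations of the box are bounded by those of larger tori. -/
lemma free_le_tcorr (d N m L : ℕ) [NeZero N] (hLN : L ∣ N) (hm : m ≤ N) {x : ℝ}
    (hx : 0 ≤ x) (t : ℝ) (b : FreeBond d m) (p : Fin d → ℤ)
    (hp : ∀ j, (L : ℤ) ∣ p j - (b.1.1 j : ℕ)) :
    nlM (freeEnds d m) (freeInterp d m L x t) b ≤ tcorr d N L x t p b.1.2 := by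
  -- The translation carrying `b` to `p`. It is a multiple of `L` in each coordinate, so corridor
  -- bonds go to corridor bonds; `m ≤ N` keeps it injective modulo `N`.
  let a : Fin d → ℤ := fun j => p j - (b.1.1 j : ℕ)
  let φ : (Fin d → Fin m) → Fin d → ZMod N := fun n j => (((n j : ℕ) + a j : ℤ) : ZMod N)
  have hφ : φ.Injective := fun n n' h => by
    ext j
    have h1 := congrFun h j
    simp only [φ, Int.cast_add, Int.cast_natCast, add_left_inj] at h1
    have h2 := congrArg ZMod.val h1
    rwa [ZMod.val_natCast_of_lt ((n j).2.trans_le hm),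
      ZMod.val_natCast_of_lt ((n' j).2.trans_le hm)] at h2
  have h := nlM_le_of_embedding (freeEnds d m) (torusEnds d N) φ hφ
    (fun b => (φ b.1.1, b.1.2)) (fun b b' h => by
      simp only [Prod.mk.injEq] at h
      exact Subtype.ext (Prod.ext (hφ h.1) h.2)) (fun b => ?_)
    (freeInterp d m L x t) (interp d N L x t)
    (scaled_nonneg _ _ _ _ hx fun _ => hx) (interp_nonneg d N L hx t) (fun b => le_of_eq ?_) b
  · refine h.trans (le_of_eq ?_)
    unfold tcorr
    congr 2
    ext j
    simp [φ, a]
  · obtain ⟨⟨n, i⟩, hb⟩ := b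
    simp only [φ, torusEnds_intCast, Prod.map, freeEnds, Prod.mk.injEq, true_and]
    ext j
    by_cases hj : j = i
    · subst hj
      simp only [Pi.single_eq_same, Function.update_self]
      push_cast; ring
    · simp [hj]
  · obtain ⟨⟨n, i⟩, hb⟩ := b
    unfold interp freeInterp scaled
    simp only [φ, mem_corridor_iff d N L hLN, freeCorridor, Finset.mem_filter, Finset.mem_univ,
      true_and]
    have : L ∣ (n i : ℕ) + 1 ↔ (L : ℤ) ∣ (n i : ℕ) + a i + 1 := by
      rw [show ((n i : ℕ) : ℤ) + a i + 1 = ((n i : ℕ) + 1) + a i by ring, dvd_add_left (hp i),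
        ← Int.natCast_dvd_natCast]
      simp
    simp only [this]

/-- The representative of a bond of the cell in the lattice. -/
def cellPoint {d L : ℕ} (n : Fin d → Fin L) (j : Fin d) : ℤ := ((n j : ℕ) : ℤ)

lemma sum_corridor_nlM (d k L : ℕ) [NeZero k] [NeZero L] {x : ℝ} (hx : 0 ≤ x) (t : ℝ)
    (f : ℝ → ℝ) :
    ∑ b ∈ corridor d (k * L) L, f (nlM (torusEnds d (k * L)) (interp d (k * L) L x t) b)
      = (k : ℝ) ^ d * ∑ q ∈ cellCorridor d L, f (tcorr d (k * L) L x t (cellPoint q.1) q.2) := by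
  rw [sum_corridor]
  have : ∀ (v : Fin d → Fin k) (q : (Fin d → Fin L) × Fin d),
      nlM (torusEnds d (k * L)) (interp d (k * L) L x t) (siteSplit d k L (q.1, v), q.2)
        = tcorr d (k * L) L x t (cellPoint q.1) q.2 := by
    intro v q
    rw [tcorr_eq_of_dvd d (k * L) L (dvd_mul_left L k) hx t (cellPoint q.1)
      (fun j => ((q.1 j : ℕ) : ℤ) + L * (v j : ℕ)) (fun j => by simp [cellPoint]), tcorr]
    congr 2
    ext j
    rw [siteSplit_apply]
    push_cast
    rfl
  simp [this]

/-- Sums over the corridor of a box are bounded by sums over the cell. -/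
lemma sum_freeCorridor_le (d M L : ℕ) [NeZero L] (f : FreeBond d (M * L) → ℝ)
    (u : (Fin d → Fin L) × Fin d → ℝ) (hu0 : ∀ q, 0 ≤ u q)
    (hu : ∀ (b : FreeBond d (M * L)) (q : (Fin d → Fin L) × Fin d),
      (∀ j, (L : ℤ) ∣ cellPoint q.1 j - (b.1.1 j : ℕ)) → q.2 = b.1.2 → f b ≤ u q) :
    ∑ b ∈ freeCorridor d (M * L) L, f b ≤ (M : ℝ) ^ d * ∑ q ∈ cellCorridor d L, u q := by
  have hL := NeZero.pos L
  -- Position within its box of side `L`, and the index of that box.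
  let ρ : FreeBond d (M * L) → ((Fin d → Fin L) × Fin d) × (Fin d → Fin M) := fun b =>
    ((fun j => ⟨(b.1.1 j : ℕ) % L, Nat.mod_lt _ hL⟩, b.1.2),
      fun j => ⟨(b.1.1 j : ℕ) / L, Nat.div_lt_of_lt_mul ((b.1.1 j).2.trans_eq (mul_comm M L))⟩)
  have hρ : ρ.Injective := by
    rintro ⟨⟨n, i⟩, hb⟩ ⟨⟨n', i'⟩, hb'⟩ h
    simp only [ρ, Prod.mk.injEq, funext_iff, Fin.mk.injEq] at h
    obtain ⟨⟨h1, rfl⟩, h2⟩ := h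
    refine Subtype.ext (Prod.ext ?_ rfl)
    ext j
    rw [← Nat.mod_add_div (n j : ℕ) L, h1 j, h2 j, Nat.mod_add_div]
  calc ∑ b ∈ freeCorridor d (M * L) L, f b
      ≤ ∑ b ∈ freeCorridor d (M * L) L, u (ρ b).1 := by
        refine Finset.sum_le_sum fun b _ => hu b _ (fun j => ?_) rfl
        simp only [ρ, cellPoint]
        have := Int.emod_add_mul_ediv ((b.1.1 j : ℕ) : ℤ) L
        refine ⟨-(((b.1.1 j : ℕ) : ℤ) / L), ?_⟩
        push_cast
        linarith
    _ = ∑ p ∈ (freeCorridor d (M * L) L).image ρ, u p.1 :=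
        (Finset.sum_image (f := fun p => u p.1) fun b _ b' _ h => hρ h).symm
    -- The bonds that would leave the large box are missing from the image; `0 ≤ u` allows adding
    -- them.
    _ ≤ ∑ p ∈ cellCorridor d L ×ˢ Finset.univ, u p.1 := by
        refine Finset.sum_le_sum_of_subset_of_nonneg ?_ fun p _ _ => hu0 _
        intro p hp
        obtain ⟨b, hb, rfl⟩ := Finset.mem_image.1 hp
        simp only [freeCorridor, Finset.mem_filter, Finset.mem_univ, true_and] at hb
        simp only [Finset.mem_product, Finset.mem_univ, and_true, cellCorridor,
          Finset.mem_filter, true_and]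
        rw [← dvd_succ_fin_iff]
        simp only [ρ]
        rw [Nat.dvd_iff_mod_eq_zero, Nat.mod_add_mod, ← Nat.dvd_iff_mod_eq_zero]
        exact hb
    _ = _ := by
        rw [Finset.sum_product]
        simp [Finset.mul_sum]

/-- Without couplings the expectation of a bond that is not a loop vanishes. -/
lemma nlM_zero {V B : Type} [Fintype V] [DecidableEq V] [Fintype B] (e : B → V × V) (b : B)
    (hb : (e b).1 ≠ (e b).2) : nlM e (fun _ => 0) b = 0 := by
  have h : ∀ g : B → ℝ, mean e (nlField (fun _ => 0) g) b = 0 := by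
    intro g
    -- Flipping the spin at one end point reverses `S_b` and preserves the zero fields, so the mean
    -- equals its opposite.
    have hT : bondSpin e (Pi.mulSingle (e b).1 (-1)) b = -1 := by
      simp [bondSpin, hb.symm]
    have h1 := mean_gauge e (fun _ => 0) (Pi.mulSingle (e b).1 (-1)) b
    simp only [mul_zero, hT] at h1
    have h2 : nlField (fun _ : B => (0 : ℝ)) g = fun _ => 0 := by ext; simp [nlField]
    rw [h2]
    linarith
  simp [nlM, h]

lemma tcorr_zero (d N L : ℕ) [NeZero N] (hN : 1 < N) (t : ℝ) (n : Fin d → ℤ) (i : Fin d) :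
    tcorr d N L 0 t n i = 0 := by
  have h : interp d N L 0 t = fun _ => 0 := by ext b; simp [interp]
  rw [tcorr, h]
  refine nlM_zero _ _ fun h => ?_
  have : Fact (1 < N) := ⟨hN⟩
  have h1 := congrFun h i
  simp [torusEnds] at h1

end Geometry

/-! ### Convergence of real sequences, of convex functions and of their slopes. -/

section Convergence

/-- Two sequences that approximate each other along multiples converge to the same limit. -/
lemma exists_common_limit (f g : ℕ → ℝ) (C : ℝ)
    (h : ∀ k m n : ℕ, n + 1 = (k + 1) * (m + 1) → |f n - g m| ≤ C / (m + 1)) :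
    ∃ l, Tendsto f atTop (𝓝 l) ∧ Tendsto g atTop (𝓝 l) := by
  have hC : 0 ≤ C := by
    have := (abs_nonneg _).trans (h 0 0 0 rfl)
    simpa using this
  have hfg : ∀ n, |f n - g n| ≤ C / (n + 1) := fun n => h 0 n n (by ring)
  have h0 : ∀ c : ℝ, Tendsto (fun n : ℕ => c / ((n : ℝ) + 1)) atTop (𝓝 0) := fun c =>
    tendsto_const_nhds.div_atTop (tendsto_atTop_add_const_right _ _ tendsto_natCast_atTop_atTop)
  have hg : CauchySeq g := by
    refine cauchySeq_of_le_tendsto_0 (fun N : ℕ => (2 * C) / ((N : ℝ) + 1)) (fun n m N hn hm => ?_)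
      (h0 _)
    have hN : (0 : ℝ) < N + 1 := by positivity
    -- Both `g n` and `g m` are compared with `f` at the common multiple `(n + 1) * (m + 1)`, with
    -- indices shifted by one.
    have h1 := h m n ((n + 1) * (m + 1) - 1) (by
      rw [Nat.sub_add_cancel (Nat.mul_pos n.succ_pos m.succ_pos), mul_comm])
    have h2 := h n m ((n + 1) * (m + 1) - 1) (by
      rw [Nat.sub_add_cancel (Nat.mul_pos n.succ_pos m.succ_pos)])
    have h3 : C / ((n : ℝ) + 1) ≤ C / (N + 1) := by
      have : (N : ℝ) ≤ n := by exact_mod_cast hn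
      gcongr
    have h4 : C / ((m : ℝ) + 1) ≤ C / (N + 1) := by
      have : (N : ℝ) ≤ m := by exact_mod_cast hm
      gcongr
    rw [Real.dist_eq, show (2 * C) / ((N : ℝ) + 1) = C / (N + 1) + C / (N + 1) by ring]
    rw [abs_le] at *
    constructor <;> linarith
  obtain ⟨l, hl⟩ := cauchySeq_tendsto_of_complete hg
  refine ⟨l, ?_, hl⟩
  have h5 : Tendsto (fun n => f n - g n) atTop (𝓝 0) := squeeze_zero_norm hfg (h0 C)
  simpa using h5.add hl

/-- Derivatives of convex functions converge where the limit function is differentiable, that is,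
at all but countably many points. -/
lemma exists_tendsto_slope {ι : Type} (l : Filter ι) [l.NeBot] (F D : ι → ℝ → ℝ) (Φ : ℝ → ℝ) (K : ℝ)
    (hmono : ∀ i, Monotone (D i)) (h0 : ∀ i t, 0 ≤ D i t) (hK : ∀ i t, D i t ≤ K)
    (hle : ∀ i t s, 0 ≤ t → t ≤ s → D i t * (s - t) ≤ F i s - F i t)
    (hge : ∀ i t s, 0 ≤ t → t ≤ s → F i s - F i t ≤ D i s * (s - t))
    (hF : ∀ t ∈ Set.Icc (0 : ℝ) 1, Tendsto (fun i => F i t) l (𝓝 (Φ t))) :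
    ∃ U : ℝ → ℝ, ∃ E : Set ℝ, E.Countable ∧
      ∀ t ∈ Set.Icc (0 : ℝ) 1, t ∉ E → Tendsto (fun i => D i t) l (𝓝 (U t)) := by
  -- The upper limit is monotone, so its discontinuities are countable. At a point of continuity
  -- only the lower bound on `D i t` needs proof; `0` is excluded to leave room on its left.
  set U : ℝ → ℝ := fun t => limsup (fun i => D i t) l with hU
  have hbdd : ∀ t, IsBoundedUnder (· ≤ ·) l fun i => D i t := fun t =>
    isBoundedUnder_of ⟨K, fun i => hK i t⟩
  have hcob : ∀ t, IsCoboundedUnder (· ≤ ·) l fun i => D i t := fun t =>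
    IsBoundedUnder.isCoboundedUnder_le (isBoundedUnder_of ⟨0, fun i => h0 i t⟩)
  have hUm : Monotone U := fun t s hts =>
    limsup_le_limsup (Eventually.of_forall fun i => hmono i hts) (hcob t) (hbdd s)
  refine ⟨U, {t | ¬ ContinuousAt U t} ∪ {0}, hUm.countable_not_continuousAt.union
    (Set.countable_singleton 0), fun t ht htE => ?_⟩
  simp only [Set.mem_union, Set.mem_ofPred_eq, Set.mem_singleton_iff, not_or, not_not] at htE
  obtain ⟨hc, ht0⟩ := htE
  have htpos : 0 < t := lt_of_le_of_ne ht.1 (Ne.symm ht0)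
  refine tendsto_order.2 ⟨fun a ha => ?_, fun a ha => eventually_lt_of_limsup_lt ha (hbdd t)⟩
  have h1 : ∀ᶠ s in 𝓝[<] t, a < U s ∧ s ∈ Set.Ioo 0 t := by
    refine Eventually.and ?_ (Ioo_mem_nhdsLT htpos)
    exact (hc.tendsto.mono_left nhdsWithin_le_nhds).eventually (lt_mem_nhds ha)
  obtain ⟨s, has, hs0, hst⟩ := h1.exists
  obtain ⟨a', haa', ha's⟩ := exists_between has
  have hlim : Tendsto (fun i => (F i t - F i s) / (t - s)) l (𝓝 ((Φ t - Φ s) / (t - s))) :=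
    ((hF t ht).sub (hF s ⟨hs0.le, hst.le.trans ht.2⟩)).div_const _
  have hpos : 0 < t - s := sub_pos.2 hst
  -- The chord slope of `Φ` on `[s, t]` is at least the upper limit `U s > a`, while the chord
  -- slopes of `F i` bound `D i t` from below.
  have h2 : a < (Φ t - Φ s) / (t - s) := by
    by_contra hcon
    have h3 : ∀ᶠ i in l, D i s ≤ a' := by
      filter_upwards [hlim.eventually (gt_mem_nhds ((not_lt.1 hcon).trans_lt haa'))] with i hi
      rw [div_lt_iff₀ hpos] at hi
      exact le_of_mul_le_mul_right ((hle i s t hs0.le hst.le).trans hi.le) hpos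
    exact absurd (limsup_le_of_le (hcob s) h3) (not_le.2 ha's)
  filter_upwards [hlim.eventually (lt_mem_nhds h2)] with i hi
  rw [lt_div_iff₀ hpos] at hi
  exact lt_of_mul_lt_mul_right (hi.trans_le (hge i s t hs0.le hst.le)) hpos.le

/-- If the sum of finitely many sequences converges to at most the sum of eventual lower bounds, each
of the sequences converges. -/
lemma tendsto_of_sum_le {κ : Type} (s : Finset κ) (c : ℕ → κ → ℝ) (b : κ → ℝ) (S : ℝ)
    (hb : ∀ q ∈ s, ∀ a < b q, ∀ᶠ k in atTop, a < c k q)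
    (hS : Tendsto (fun k => ∑ q ∈ s, c k q) atTop (𝓝 S)) (hle : S ≤ ∑ q ∈ s, b q) :
    ∀ q ∈ s, Tendsto (fun k => c k q) atTop (𝓝 (b q)) := by
  classical
  intro q hq
  refine tendsto_order.2 ⟨hb q hq, fun a ha => ?_⟩
  have hn : (0 : ℝ) < s.card + 1 := by positivity
  -- The total may exceed its limit by `ε` and each of the other `s.card - 1` terms may fall short
  -- by `ε`; so `c k q` stays below `b q + s.card * ε < a`.
  set ε := (a - b q) / (s.card + 1) with hε
  have hεpos : 0 < ε := div_pos (sub_pos.2 ha) hn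
  have h1 : ∀ᶠ k in atTop, ∀ r ∈ s, b r - ε < c k r :=
    (eventually_all_finset s).2 fun r hr => hb r hr _ (by linarith)
  have h2 : ∀ᶠ k in atTop, ∑ r ∈ s, c k r < S + ε := hS.eventually (gt_mem_nhds (by linarith))
  filter_upwards [h1, h2] with k hk1 hk2
  rw [← Finset.add_sum_erase _ _ hq] at hk2 hle
  have h3 : ∑ r ∈ s.erase q, (b r - ε) ≤ ∑ r ∈ s.erase q, c k r :=
    Finset.sum_le_sum fun r hr => (hk1 r (Finset.mem_of_mem_erase hr)).le
  rw [Finset.sum_sub_distrib, Finset.sum_const, nsmul_eq_mul, Finset.card_erase_of_mem hq,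
    Nat.cast_sub (Finset.card_pos.2 ⟨q, hq⟩)] at h3
  have h4 : ε * (s.card + 1) = a - b q := div_mul_cancel₀ _ hn.ne'
  push_cast at h3
  nlinarith

end Convergence

/-! ### Convexity of the pressure in the interpolation parameter. -/

section SlopeBounds

variable {V B : Type} [Fintype V] [DecidableEq V] [Fintype B]

/-- The derivative of the pressure in the interpolation parameter. -/
def slopeFn (e : B → V × V) (C : Finset B) [DecidablePred (· ∈ C)] (y : B → ℝ) (r t : ℝ) : ℝ :=
  r ^ 2 / 2 * ∑ b ∈ C, (1 + nlM e (scaled C y r t) b)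

variable (e : B → V × V) (C : Finset B) [DecidablePred (· ∈ C)] (y : B → ℝ) {r : ℝ}

lemma monotone_slopeFn (hr : 0 ≤ r) (hy : ∀ b, 0 ≤ y b) : Monotone (slopeFn e C y r) := by
  intro t s hts
  unfold slopeFn
  gcongr with b _
  exact monotone_nlM_scaled e C y r hr hy b hts

lemma slopeFn_nonneg (t : ℝ) : 0 ≤ slopeFn e C y r t :=
  mul_nonneg (by positivity) (Finset.sum_nonneg fun b _ => by linarith [nlM_nonneg e (scaled C y r t) b])

/-- The increment is the integral of a monotone slope, bounded below by the slope at the left end;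
the next lemma uses the right end. -/
lemma slopeFn_mul_le (hr : 0 ≤ r) (hy : ∀ b, 0 ≤ y b) {t s : ℝ} (ht : 0 ≤ t) (hts : t ≤ s) :
    slopeFn e C y r t * (s - t) ≤ nlP e (scaled C y r s) - nlP e (scaled C y r t) := by
  have hm := monotone_slopeFn e C y hr hy
  rw [← nlP_scaled_sub e C y r hr hy ht hts]
  have h := intervalIntegral.integral_mono_on hts (intervalIntegrable_const (c := slopeFn e C y r t))
    (hm.intervalIntegrable (μ := volume)) fun u hu => hm hu.1
  rw [intervalIntegral.integral_const, smul_eq_mul, mul_comm] at h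
  exact h

lemma le_slopeFn_mul (hr : 0 ≤ r) (hy : ∀ b, 0 ≤ y b) {t s : ℝ} (ht : 0 ≤ t) (hts : t ≤ s) :
    nlP e (scaled C y r s) - nlP e (scaled C y r t) ≤ slopeFn e C y r s * (s - t) := by
  have hm := monotone_slopeFn e C y hr hy
  rw [← nlP_scaled_sub e C y r hr hy ht hts]
  have h := intervalIntegral.integral_mono_on hts (hm.intervalIntegrable (μ := volume))
    (intervalIntegrable_const (c := slopeFn e C y r s)) fun u hu => hm hu.2
  rw [intervalIntegral.integral_const, smul_eq_mul, mul_comm (s - t)] at h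
  exact h

end SlopeBounds

/-! ### Thermodynamic limit of pressures and of corridor correlations. -/

section ThermodynamicLimit

variable (d L : ℕ) [NeZero L] {x : ℝ}

/-- The pressure per box of the torus of side `(k + 1) L`. -/
def torusP (x t : ℝ) (k : ℕ) : ℝ :=
  nlP (torusEnds d ((k + 1) * L)) (interp d ((k + 1) * L) L x t) / ((k : ℝ) + 1) ^ d

/-- The pressure per box of the box of side `(k + 1) L`. -/
def boxP (x t : ℝ) (k : ℕ) : ℝ :=
  nlP (freeEnds d ((k + 1) * L)) (freeInterp d ((k + 1) * L) L x t) / ((k : ℝ) + 1) ^ d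

omit [NeZero L] in
lemma nlP_torus_congr {N N' : ℕ} [NeZero N] [NeZero N'] (h : N = N') (x t : ℝ) :
    nlP (torusEnds d N) (interp d N L x t) = nlP (torusEnds d N') (interp d N' L x t) := by
  subst h; rfl

/-- Cutting a torus into boxes of side `(m + 1) L` costs, per box of side `L`, an amount of order `1
/ (m + 1)`, uniformly in the number of pieces. -/
lemma exists_tendsto_pressure (hd : 1 ≤ d) (hx : 0 ≤ x) {t : ℝ} (ht : t ≤ 1) :
    ∃ p, Tendsto (torusP d L x t) atTop (𝓝 p) ∧ Tendsto (boxP d L x t) atTop (𝓝 p) := by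
  refine exists_common_limit _ _ (2 * x ^ 2 * (d * (L : ℝ) ^ (d - 1))) fun k m n hn => ?_
  have h := abs_torus_sub_free_le d (k + 1) ((m + 1) * L) L (dvd_mul_left _ _) hx ht
  have hN : (n + 1) * L = (k + 1) * ((m + 1) * L) := by rw [hn, mul_assoc]
  have hnr : (n : ℝ) + 1 = (k + 1) * (m + 1) := by exact_mod_cast hn
  rw [torusP, boxP, nlP_torus_congr d L hN, hnr]
  set P := nlP (torusEnds d ((k + 1) * ((m + 1) * L))) (interp d ((k + 1) * ((m + 1) * L)) L x t)
  set Q := nlP (freeEnds d ((m + 1) * L)) (freeInterp d ((m + 1) * L) L x t)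
  have hk : (0 : ℝ) < (k : ℝ) + 1 := by positivity
  have hm : (0 : ℝ) < (m : ℝ) + 1 := by positivity
  push_cast at h
  have e1 : P / (((k : ℝ) + 1) * (m + 1)) ^ d - Q / ((m : ℝ) + 1) ^ d
      = (P - ((k : ℝ) + 1) ^ d * Q) / (((k : ℝ) + 1) * (m + 1)) ^ d := by
    rw [mul_pow]
    field_simp
  rw [e1, abs_div, abs_of_pos (by positivity : (0 : ℝ) < (((k : ℝ) + 1) * (m + 1)) ^ d),
    div_le_iff₀ (by positivity)]
  refine h.trans (le_of_eq ?_)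
  obtain ⟨d', rfl⟩ : ∃ d', d = d' + 1 := ⟨d - 1, by omega⟩
  simp only [Nat.add_sub_cancel, mul_pow]
  field_simp
  ring

lemma torusP_slope (hx : 0 ≤ x) (t : ℝ) (k : ℕ) :
    slopeFn (torusEnds d ((k + 1) * L)) (corridor d ((k + 1) * L) L) (fun _ => x) x t
      = ((k : ℝ) + 1) ^ d * (x ^ 2 / 2 * ∑ q ∈ cellCorridor d L,
        (1 + tcorr d ((k + 1) * L) L x t (cellPoint q.1) q.2)) := by
  have h := sum_corridor_nlM d (k + 1) L hx t fun z => 1 + z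
  unfold slopeFn
  rw [← interp_eq, h]
  push_cast
  ring

/-- Used with `u = 1` for a uniform bound on the slopes, and with `u` the lower limits of the torus
correlations. -/
lemma boxP_slope_le (u : (Fin d → Fin L) × Fin d → ℝ) (hu0 : ∀ q, 0 ≤ u q) (t : ℝ) (m : ℕ)
    (hu : ∀ (b : FreeBond d ((m + 1) * L)) (q : (Fin d → Fin L) × Fin d),
      (∀ j, (L : ℤ) ∣ cellPoint q.1 j - (b.1.1 j : ℕ)) → q.2 = b.1.2 →
      nlM (freeEnds d ((m + 1) * L)) (freeInterp d ((m + 1) * L) L x t) b ≤ u q) :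
    slopeFn (freeEnds d ((m + 1) * L)) (freeCorridor d ((m + 1) * L) L) (fun _ => x) x t
      / ((m : ℝ) + 1) ^ d ≤ x ^ 2 / 2 * ∑ q ∈ cellCorridor d L, (1 + u q) := by
  have h := sum_freeCorridor_le d (m + 1) L
    (fun b => 1 + nlM (freeEnds d ((m + 1) * L)) (freeInterp d ((m + 1) * L) L x t) b)
    (fun q => 1 + u q) (fun q => by linarith [hu0 q])
    (fun b q h1 h2 => by linarith [hu b q h1 h2])
  push_cast at h
  rw [div_le_iff₀ (by positivity)]
  calc _ ≤ x ^ 2 / 2 * ((m + 1) ^ d * ∑ q ∈ cellCorridor d L, (1 + u q)) :=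
        mul_le_mul_of_nonneg_left h (by positivity)
    _ = _ := by ring

omit [NeZero L] in
lemma tcorr_nonneg (N : ℕ) [NeZero N] (t : ℝ) (n : Fin d → ℤ) (i : Fin d) :
    0 ≤ tcorr d N L x t n i := nlM_nonneg _ _ _

omit [NeZero L] in
lemma tcorr_le_one (N : ℕ) [NeZero N] (t : ℝ) (n : Fin d → ℤ) (i : Fin d) :
    tcorr d N L x t n i ≤ 1 := nlM_le_one _ _ _

/-- The correlations of the corridor bonds converge for all but countably many parameters. -/
theorem exists_countable_tendsto_tcorr_of_pos (hd : 1 ≤ d) (hx : 0 < x) :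
    ∃ E : Set ℝ, E.Countable ∧ ∀ t ∈ Set.Icc (0 : ℝ) 1, t ∉ E → ∀ q ∈ cellCorridor d L, ∃ l,
      Tendsto (fun k : ℕ => tcorr d ((k + 1) * L) L x t (cellPoint q.1) q.2) atTop (𝓝 l) := by
  let Tslope : ℕ → ℝ → ℝ := fun k t =>
    slopeFn (torusEnds d ((k + 1) * L)) (corridor d ((k + 1) * L) L) (fun _ => x) x t
      / ((k : ℝ) + 1) ^ d
  let Bslope : ℕ → ℝ → ℝ := fun k t =>
    slopeFn (freeEnds d ((k + 1) * L)) (freeCorridor d ((k + 1) * L) L) (fun _ => x) x t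
      / ((k : ℝ) + 1) ^ d
  -- Tori and boxes are treated as one family, so that their slopes have the same limit outside a
  -- single countable set.
  let l : Filter (ℕ ⊕ ℕ) := map Sum.inl atTop ⊔ map Sum.inr atTop
  have hTs : ∀ k t, Tslope k t = x ^ 2 / 2 * ∑ q ∈ cellCorridor d L,
      (1 + tcorr d ((k + 1) * L) L x t (cellPoint q.1) q.2) := fun k t => by
    simp only [Tslope, torusP_slope d L hx.le t k]
    field_simp
  have hpos : ∀ k : ℕ, (0 : ℝ) < ((k : ℝ) + 1) ^ d := fun k => by positivity
  set K : ℝ := x ^ 2 / 2 * ∑ q ∈ cellCorridor d L, (1 + 1 : ℝ) with hK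
  let F : ℕ ⊕ ℕ → ℝ → ℝ := Sum.elim (fun k t => torusP d L x t k) fun k t => boxP d L x t k
  choose! Φ hΦT hΦB using fun t (ht : t ∈ Set.Icc (0 : ℝ) 1) =>
    exists_tendsto_pressure d L hd hx.le ht.2
  have key := exists_tendsto_slope l F (Sum.elim Tslope Bslope) Φ K ?_ ?_ ?_ ?_ ?_ ?_
  · obtain ⟨U, E, hE, hU⟩ := key
    refine ⟨E, hE, fun t ht htE => ?_⟩
    have hlim := hU t ht htE
    rw [tendsto_sup, tendsto_map'_iff, tendsto_map'_iff] at hlim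
    obtain ⟨hT, hB⟩ := hlim
    change Tendsto (fun k => Tslope k t) atTop (𝓝 (U t)) at hT
    change Tendsto (fun k => Bslope k t) atTop (𝓝 (U t)) at hB
    let c : ℕ → (Fin d → Fin L) × Fin d → ℝ := fun k q =>
      tcorr d ((k + 1) * L) L x t (cellPoint q.1) q.2
    let b : (Fin d → Fin L) × Fin d → ℝ := fun q => liminf (fun k => c k q) atTop
    have hbd : ∀ q, IsBoundedUnder (· ≥ ·) atTop fun k => c k q := fun q =>
      isBoundedUnder_of ⟨0, fun k => tcorr_nonneg d L _ t _ _⟩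
    have hcb : ∀ q, IsCoboundedUnder (· ≥ ·) atTop fun k => c k q := fun q =>
      IsBoundedUnder.isCoboundedUnder_ge (isBoundedUnder_of ⟨1, fun k => tcorr_le_one d L _ t _ _⟩)
    have hb0 : ∀ q, 0 ≤ b q := fun q =>
      le_liminf_of_le (hcb q) (Eventually.of_forall fun k => tcorr_nonneg d L _ t _ _)
    -- Each box embeds in all larger tori, so its correlations are below the lower limits `b`;
    -- letting the box grow bounds the common slope `U t`.
    have hUb : U t ≤ x ^ 2 / 2 * ∑ q ∈ cellCorridor d L, (1 + b q) := by
      refine le_of_tendsto' hB fun m => boxP_slope_le d L b hb0 t m fun f q h1 h2 => ?_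
      refine le_liminf_of_le (hcb q) ?_
      filter_upwards [eventually_ge_atTop m] with k hk
      have := free_le_tcorr d ((k + 1) * L) ((m + 1) * L) L (dvd_mul_left _ _)
        (Nat.mul_le_mul_right L (by omega)) hx.le t f (cellPoint q.1) h1
      rw [← h2] at this
      exact this
    have hx2 : 0 < x ^ 2 / 2 := by positivity
    have hS : Tendsto (fun k => ∑ q ∈ cellCorridor d L, c k q) atTop
        (𝓝 (U t / (x ^ 2 / 2) - (cellCorridor d L).card)) := by
      refine ((hT.div_const (x ^ 2 / 2)).sub_const ((cellCorridor d L).card : ℝ)).congr fun k => ?_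
      rw [hTs, mul_div_cancel_left₀ _ hx2.ne', Finset.sum_add_distrib]
      simp [c]
    have hSb : U t / (x ^ 2 / 2) - (cellCorridor d L).card ≤ ∑ q ∈ cellCorridor d L, b q := by
      rw [sub_le_iff_le_add, div_le_iff₀ hx2]
      refine hUb.trans (le_of_eq ?_)
      rw [Finset.sum_add_distrib]
      simp
      ring
    intro q hq
    exact ⟨b q, tendsto_of_sum_le (cellCorridor d L) c b _
      (fun q _ a ha => eventually_lt_of_lt_liminf ha (hbd q)) hS hSb q hq⟩
  · rintro (k | k) t s hts
    · exact div_le_div_of_nonneg_right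
        (monotone_slopeFn _ _ _ hx.le (fun _ => hx.le) hts) (hpos k).le
    · exact div_le_div_of_nonneg_right
        (monotone_slopeFn _ _ _ hx.le (fun _ => hx.le) hts) (hpos k).le
  · rintro (k | k) t
    · exact div_nonneg (slopeFn_nonneg _ _ _ t) (hpos k).le
    · exact div_nonneg (slopeFn_nonneg _ _ _ t) (hpos k).le
  · rintro (k | k) t
    · change Tslope k t ≤ K
      rw [hTs]
      refine mul_le_mul_of_nonneg_left (Finset.sum_le_sum fun q _ => ?_) (by positivity)
      linarith [tcorr_le_one d L (x := x) ((k + 1) * L) t (cellPoint q.1) q.2]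
    · exact boxP_slope_le d L (fun _ => 1) (fun _ => zero_le_one) t k
        fun b q _ _ => nlM_le_one _ _ _
  · rintro (k | k) t s ht hts
    · have := slopeFn_mul_le (torusEnds d ((k + 1) * L)) (corridor d ((k + 1) * L) L) (fun _ => x)
        hx.le (fun _ => hx.le) ht hts
      have := div_le_div_of_nonneg_right this (hpos k).le
      rw [sub_div, mul_div_right_comm] at this
      exact this
    · have := slopeFn_mul_le (freeEnds d ((k + 1) * L)) (freeCorridor d ((k + 1) * L) L) (fun _ => x)
        hx.le (fun _ => hx.le) ht hts
      have := div_le_div_of_nonneg_right this (hpos k).le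
      rw [sub_div, mul_div_right_comm] at this
      exact this
  · rintro (k | k) t s ht hts
    · have := le_slopeFn_mul (torusEnds d ((k + 1) * L)) (corridor d ((k + 1) * L) L) (fun _ => x)
        hx.le (fun _ => hx.le) ht hts
      have := div_le_div_of_nonneg_right this (hpos k).le
      rw [sub_div, mul_div_right_comm] at this
      exact this
    · have := le_slopeFn_mul (freeEnds d ((k + 1) * L)) (freeCorridor d ((k + 1) * L) L) (fun _ => x)
        hx.le (fun _ => hx.le) ht hts
      have := div_le_div_of_nonneg_right this (hpos k).le
      rw [sub_div, mul_div_right_comm] at this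
      exact this
  · intro t ht
    rw [tendsto_sup, tendsto_map'_iff, tendsto_map'_iff]
    exact ⟨hΦT t ht, hΦB t ht⟩

theorem exists_countable_tendsto_tcorr (hd : 1 ≤ d) (hx : 0 ≤ x) :
    ∃ E : Set ℝ, E.Countable ∧ ∀ t ∈ Set.Icc (0 : ℝ) 1, t ∉ E →
      ∀ (n : Fin d → ℤ) (i : Fin d), (L : ℤ) ∣ n i + 1 → ∃ l,
        Tendsto (fun k : ℕ => tcorr d ((k + 1) * L) L x t n i) atTop (𝓝 l) := by
  rcases hx.eq_or_lt with rfl | hpos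
  -- At `x = 0` the slopes carry no information, but the correlations vanish. For `k ≥ 1` the side
  -- is at least `2`, so that no bond is a loop.
  · refine ⟨∅, Set.countable_empty, fun t _ _ n i _ => ⟨0, ?_⟩⟩
    refine tendsto_const_nhds.congr' ?_
    filter_upwards [eventually_ge_atTop 1] with k hk
    refine (tcorr_zero d ((k + 1) * L) L ?_ t n i).symm
    have := NeZero.pos L
    nlinarith
  · obtain ⟨E, hE, h⟩ := exists_countable_tendsto_tcorr_of_pos d L hd hpos
    refine ⟨E, hE, fun t ht htE n i hi => ?_⟩
    have hL : (0 : ℤ) < L := by exact_mod_cast NeZero.pos L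
    -- The representative of `n` in the cell; translation invariance by multiples of `L` transfers
    -- the convergence.
    let m : Fin d → Fin L := fun j => ⟨(n j % L).toNat, by
      have := Int.emod_lt_of_pos (n j) hL
      have := Int.emod_nonneg (n j) hL.ne'
      omega⟩
    have hm : ∀ j, cellPoint m j = n j % L := fun j =>
      Int.toNat_of_nonneg (Int.emod_nonneg (n j) hL.ne')
    have hdiv : ∀ j, (L : ℤ) ∣ n j - cellPoint m j := fun j => by
      rw [hm]; exact Int.dvd_self_sub_emod
    have hq : (m, i) ∈ cellCorridor d L := by
      simp only [cellCorridor, Finset.mem_filter, Finset.mem_univ, true_and]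
      rw [← dvd_succ_fin_iff, ← Int.natCast_dvd_natCast]
      have := dvd_sub hi (hdiv i)
      push_cast
      change (L : ℤ) ∣ cellPoint m i + 1
      rwa [show n i + 1 - (n i - cellPoint m i) = cellPoint m i + 1 by ring] at this
    obtain ⟨l, hl⟩ := h t ht htE (m, i) hq
    exact ⟨l, hl.congr fun k => tcorr_eq_of_dvd d _ L (dvd_mul_left _ _) hx t _ _ hdiv i⟩

end ThermodynamicLimit

/-! ### Integral representations of the surface pressure. -/

section SurfacePressure

variable (d L : ℕ) [NeZero L] {σ x : ℝ}

omit [NeZero L] in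
lemma torusCorr_eq (N : ℕ) [NeZero N] (hσ : 0 < σ) (t : ℝ) (n : Fin d → ℤ) (i : Fin d) :
    torusCorr d N L σ x t n i = tcorr d N L x t n i :=
  nlQuenched_bondSpin _ σ hσ _ _

/-- By translation invariance the `k ^ d` boxes contribute equally, so the average reduces to one
cell and its convergence to finitely many correlations. -/
lemma torusCorridorMean_eq_sum (k : ℕ) [NeZero k] (hσ : 0 < σ) (hx : 0 ≤ x) (t : ℝ) :
    torusCorridorMean d (k * L) L σ x t = ((cellCorridor d L).card : ℝ)⁻¹ *
      ∑ q ∈ cellCorridor d L, torusCorr d (k * L) L σ x t (cellPoint q.1) q.2 := by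
  have h1 : torusCorridorMean d (k * L) L σ x t = ((corridor d (k * L) L).card : ℝ)⁻¹ *
      ∑ b ∈ corridor d (k * L) L, nlM (torusEnds d (k * L)) (interp d (k * L) L x t) b :=
    nlQuenched_average (torusEnds d (k * L)) σ hσ _ _ _
  have h2 := sum_corridor_nlM d k L hx t fun z => z
  have hk : (k : ℝ) ^ d ≠ 0 := pow_ne_zero _ (Nat.cast_ne_zero.2 (NeZero.ne k))
  rw [h1, h2, card_corridor, card_cellCorridor]
  simp only [torusCorr_eq d L _ hσ]
  push_cast
  rw [mul_inv, mul_mul_mul_comm, inv_mul_cancel₀ hk, one_mul]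

omit [NeZero L] in
lemma monotone_torusCorr (N : ℕ) [NeZero N] (hσ : 0 < σ) (hx : 0 ≤ x) (n : Fin d → ℤ) (i : Fin d) :
    Monotone fun t => torusCorr d N L σ x t n i := by
  simp only [torusCorr_eq d L N hσ]
  exact monotone_nlM_scaled _ _ _ _ hx (fun _ => hx) _

lemma monotone_torusCorridorMean (k : ℕ) [NeZero k] (hσ : 0 < σ) (hx : 0 ≤ x) :
    Monotone fun t => torusCorridorMean d (k * L) L σ x t := by
  simp only [torusCorridorMean_eq_sum d L k hσ hx]
  intro t s hts
  have := fun q : (Fin d → Fin L) × Fin d =>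
    monotone_torusCorr d L (k * L) hσ hx (cellPoint q.1) q.2 hts
  exact mul_le_mul_of_nonneg_left (Finset.sum_le_sum fun q _ => this q) (by positivity)

lemma torusCorridorMean_mem_Icc (k : ℕ) [NeZero k] (hσ : 0 < σ) (hx : 0 ≤ x) (t : ℝ) :
    torusCorridorMean d (k * L) L σ x t ∈ Set.Icc (0 : ℝ) 1 := by
  rw [torusCorridorMean_eq_sum d L k hσ hx]
  simp only [torusCorr_eq d L _ hσ]
  constructor
  · exact mul_nonneg (by positivity) (Finset.sum_nonneg fun q _ => tcorr_nonneg _ _ _ _ _ _)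
  · have h : ∑ q ∈ cellCorridor d L, tcorr d (k * L) L x t (cellPoint q.1) q.2
        ≤ (cellCorridor d L).card := by
      refine (Finset.sum_le_sum fun q _ => tcorr_le_one _ _ _ _ _ _).trans ?_
      simp
    exact (mul_le_mul_of_nonneg_left h (by positivity)).trans inv_mul_le_one

/-- The pressure of the torus composed of `k ^ d` boxes in terms of that of the box. -/
lemma torusPressure_eq (k : ℕ) [NeZero k] (hd : 1 ≤ d) (hσ : 0 < σ) (hx : 0 ≤ x) :
    torusPressure d (k * L) σ x = (k : ℝ) ^ d * (freePressure d L σ x + d / 2 * x ^ 2 *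
      (L : ℝ) ^ (d - 1) * (1 + ∫ t in (0 : ℝ)..1, torusCorridorMean d (k * L) L σ x t)) := by
  -- Integration from `t = 0`, where the torus falls apart into free boxes, to `t = 1`, where it is
  -- homogeneous.
  have h := nlP_scaled_sub (torusEnds d (k * L)) (corridor d (k * L) L) (fun _ => x) x hx
    (fun _ => hx) le_rfl zero_le_one
  simp only [← interp_eq] at h
  rw [nlP_interp_zero, interp_one] at h
  have hcard : (0 : ℝ) < d * (L : ℝ) ^ (d - 1) := by
    have : (0 : ℝ) < L := by exact_mod_cast NeZero.pos L
    positivity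
  have hs : ∀ t, ∑ b ∈ corridor d (k * L) L,
      (1 + nlM (torusEnds d (k * L)) (interp d (k * L) L x t) b)
      = (k : ℝ) ^ d * (d * (L : ℝ) ^ (d - 1)) * (1 + torusCorridorMean d (k * L) L σ x t) := by
    intro t
    rw [sum_corridor_nlM d k L hx t fun z => 1 + z, torusCorridorMean_eq_sum d L k hσ hx,
      card_cellCorridor, Finset.sum_add_distrib, Finset.sum_const, card_cellCorridor, nsmul_eq_mul]
    simp only [torusCorr_eq d L _ hσ]
    push_cast
    have hne := hcard.ne'
    generalize (d : ℝ) * (L : ℝ) ^ (d - 1) = c at hne ⊢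
    field_simp
  simp only [hs] at h
  rw [intervalIntegral.integral_const_mul, intervalIntegral.integral_const_mul,
    intervalIntegral.integral_add intervalIntegrable_const
      (monotone_torusCorridorMean d L k hσ hx).intervalIntegrable] at h
  simp only [intervalIntegral.integral_const, sub_zero, smul_eq_mul, mul_one] at h
  have e1 : torusPressure d (k * L) σ x = nlP (torusEnds d (k * L)) (fun _ => x) :=
    nlPressure_eq _ σ hσ _
  have e2 : freePressure d L σ x = nlP (freeEnds d L) (fun _ => x) := nlPressure_eq _ σ hσ _
  rw [e1, e2]
  linear_combination -h

lemma torusPressure_congr {N N' : ℕ} [NeZero N] [NeZero N'] (h : N = N') (σ x : ℝ) :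
    torusPressure d N σ x = torusPressure d N' σ x := by
  subst h; rfl

omit [NeZero L] in
lemma torusCorridorMean_congr {N N' : ℕ} [NeZero N] [NeZero N'] (h : N = N') (σ x t : ℝ) :
    torusCorridorMean d N L σ x t = torusCorridorMean d N' L σ x t := by
  subst h; rfl

/-- At `t = 1` the interpolation is trivial, so the limit per site is the case `L = 1`, `t = 1` of
the limit per box. -/
lemma freePressure_eq_boxP (hσ : 0 < σ) (N : ℕ) :
    freePressure d (N + 1) σ x / ((N + 1 : ℕ) : ℝ) ^ d = boxP d 1 x 1 N := by
  have h : freeInterp d ((N + 1) * 1) 1 x 1 = fun _ => x := by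
    ext b; simp [freeInterp, scaled]
  rw [boxP, h, freePressure, nlPressure_eq _ σ hσ]
  push_cast
  congr 1
  rw [mul_one]

/-- The pressures per site of the box and of the torus converge to the same limit. -/
lemma tendsto_pressure (hd : 1 ≤ d) (hσ : 0 < σ) (hx : 0 ≤ x) :
    Tendsto (fun N : ℕ => freePressure d N σ x / (N : ℝ) ^ d) atTop (𝓝 (limitPressure d σ x)) ∧
    Tendsto (fun N : ℕ => torusPressure d (N + 1) σ x / ((N + 1 : ℕ) : ℝ) ^ d) atTop
      (𝓝 (limitPressure d σ x)) := by
  obtain ⟨p, hT, hB⟩ := exists_tendsto_pressure d 1 hd hx (le_refl (1 : ℝ))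
  have h1 : Tendsto (fun N : ℕ => freePressure d N σ x / (N : ℝ) ^ d) atTop (𝓝 p) := by
    rw [← tendsto_add_atTop_iff_nat 1]
    exact hB.congr fun N => (freePressure_eq_boxP d hσ N).symm
  have hp : limitPressure d σ x = p := h1.limUnder_eq
  rw [hp]
  refine ⟨h1, hT.congr fun N => ?_⟩
  rw [torusP, interp_one, torusPressure_congr d (mul_one (N + 1)).symm, torusPressure,
    nlPressure_eq _ σ hσ]
  push_cast
  rfl

/-- The correlations of the corridor bonds of the infinite system, and their average, are limits for
all but countably many parameters. -/
lemma exists_countable_tendsto (hd : 1 ≤ d) (hσ : 0 < σ) (hx : 0 ≤ x) :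
    ∃ E : Set ℝ, E.Countable ∧ ∀ t ∈ Set.Icc (0 : ℝ) 1, t ∉ E →
      (∀ (n : Fin d → ℤ) (i : Fin d), (L : ℤ) ∣ n i + 1 →
        Tendsto (fun k : ℕ => torusCorr d ((k + 1) * L) L σ x t n i) atTop
          (𝓝 (infCorr d L σ x t n i))) ∧
      Tendsto (fun k : ℕ => torusCorridorMean d ((k + 1) * L) L σ x t) atTop
        (𝓝 (infCorridorMean d L σ x t)) := by
  obtain ⟨E, hE, h⟩ := exists_countable_tendsto_tcorr d L hd hx
  refine ⟨E, hE, fun t ht htE => ?_⟩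
  have h1 : ∀ (n : Fin d → ℤ) (i : Fin d), (L : ℤ) ∣ n i + 1 →
      Tendsto (fun k : ℕ => torusCorr d ((k + 1) * L) L σ x t n i) atTop
        (𝓝 (infCorr d L σ x t n i)) := by
    intro n i hi
    obtain ⟨l, hl⟩ := h t ht htE n i hi
    refine tendsto_nhds_limUnder ⟨l, ?_⟩
    simpa only [torusCorr_eq d L _ hσ] using hl
  refine ⟨h1, ?_⟩
  simp only [torusCorridorMean_eq_sum d L _ hσ hx]
  refine Tendsto.const_mul _ (tendsto_finsetSum _ fun q hq => h1 _ _ ?_)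
  simp only [cellCorridor, Finset.mem_filter, Finset.mem_univ, true_and] at hq
  have : ((q.1 q.2 : ℕ) : ℤ) + 1 = L := by exact_mod_cast hq
  simp only [cellPoint, this, dvd_refl]

lemma ae_tendsto_torusCorridorMean (hd : 1 ≤ d) (hσ : 0 < σ) (hx : 0 ≤ x) :
    ∀ᵐ t ∂(volume.restrict (Set.uIoc (0 : ℝ) 1)),
      Tendsto (fun k : ℕ => torusCorridorMean d ((k + 1) * L) L σ x t) atTop
        (𝓝 (infCorridorMean d L σ x t)) := by
  obtain ⟨E, hE, h⟩ := exists_countable_tendsto d L hd hσ hx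
  have h1 : ∀ᵐ t ∂(volume.restrict (Set.uIoc (0 : ℝ) 1)), t ∉ E :=
    ae_restrict_of_ae (measure_eq_zero_iff_ae_notMem.1 (hE.measure_zero volume))
  filter_upwards [h1, ae_restrict_mem measurableSet_uIoc] with t htE ht
  rw [Set.uIoc_of_le zero_le_one] at ht
  exact (h t ⟨ht.1.le, ht.2⟩ htE).2

/-- On the countable exceptional set `limUnder` may take arbitrary values, so measurability is
obtained almost everywhere, from the monotone approximants. -/
lemma intervalIntegrable_infCorridorMean (hd : 1 ≤ d) (hσ : 0 < σ) (hx : 0 ≤ x) :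
    IntervalIntegrable (fun t => infCorridorMean d L σ x t) volume 0 1 := by
  have hlim := ae_tendsto_torusCorridorMean d L hd hσ hx
  rw [intervalIntegrable_iff]
  have : IsFiniteMeasure ((volume : Measure ℝ).restrict (Set.uIoc (0 : ℝ) 1)) :=
    ⟨by simp [Set.uIoc]⟩
  refine Integrable.of_bound (aestronglyMeasurable_of_tendsto_ae atTop
    (fun k => (monotone_torusCorridorMean d L (k + 1) hσ hx).measurable.aestronglyMeasurable) hlim)
    1 ?_
  filter_upwards [hlim] with t ht
  refine le_of_tendsto' ht.norm fun k => ?_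
  obtain ⟨h0, h1⟩ := torusCorridorMean_mem_Icc d L (k + 1) hσ hx t
  rwa [Real.norm_eq_abs, abs_of_nonneg h0]

lemma tendsto_integral_torusCorridorMean (hd : 1 ≤ d) (hσ : 0 < σ) (hx : 0 ≤ x) :
    Tendsto (fun k : ℕ => ∫ t in (0 : ℝ)..1, torusCorridorMean d ((k + 1) * L) L σ x t) atTop
      (𝓝 (∫ t in (0 : ℝ)..1, infCorridorMean d L σ x t)) := by
  have hlim := ae_tendsto_torusCorridorMean d L hd hσ hx
  refine intervalIntegral.tendsto_integral_filter_of_dominated_convergence (fun _ => 1)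
    (Eventually.of_forall fun k =>
      (monotone_torusCorridorMean d L (k + 1) hσ hx).measurable.aestronglyMeasurable)
    (Eventually.of_forall fun k => ae_of_all _ fun t _ => ?_) intervalIntegrable_const
    ((ae_restrict_iff' measurableSet_uIoc).1 hlim)
  obtain ⟨h0, h1⟩ := torusCorridorMean_mem_Icc d L (k + 1) hσ hx t
  rwa [Real.norm_eq_abs, abs_of_nonneg h0]

lemma integral_infCorridorMean_mem_Icc (hd : 1 ≤ d) (hσ : 0 < σ) (hx : 0 ≤ x) :
    ∫ t in (0 : ℝ)..1, infCorridorMean d L σ x t ∈ Set.Icc (0 : ℝ) 1 := by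
  refine isClosed_Icc.mem_of_tendsto (tendsto_integral_torusCorridorMean d L hd hσ hx)
    (Eventually.of_forall fun k => ⟨?_, ?_⟩)
  · exact intervalIntegral.integral_nonneg zero_le_one fun t _ =>
      (torusCorridorMean_mem_Icc d L (k + 1) hσ hx t).1
  · have h := intervalIntegral.integral_mono_on zero_le_one
      ((monotone_torusCorridorMean d L (k + 1) hσ hx).intervalIntegrable (μ := volume) (a := 0) (b := 1))
      (intervalIntegrable_const (c := (1 : ℝ)))
      fun t _ => (torusCorridorMean_mem_Icc d L (k + 1) hσ hx t).2
    simpa using h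

/-- The integral representation of the surface pressure for free boundary conditions. -/
lemma freeSurface_eq (hd : 1 ≤ d) (hσ : 0 < σ) (hx : 0 ≤ x) :
    freeSurface d L σ x = -((d : ℝ) / 2 * x ^ 2 * (L : ℝ) ^ (d - 1) *
      (1 + ∫ t in (0 : ℝ)..1, infCorridorMean d L σ x t)) := by
  have hL : 0 < L := NeZero.pos L
  -- The torus pressure per box has two expressions for its limit: here by the thermodynamic limit
  -- along multiples of `L`, next by the exact formula and dominated convergence.
  have h1 : Tendsto (fun k : ℕ => torusPressure d ((k + 1) * L) σ x / ((k : ℝ) + 1) ^ d) atTop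
      (𝓝 (limitPressure d σ x * (L : ℝ) ^ d)) := by
    have hsub : Tendsto (fun k : ℕ => (k + 1) * L - 1) atTop atTop :=
      tendsto_atTop_mono (fun k => by
        have := Nat.le_mul_of_pos_right (k + 1) hL
        simp only [id]
        omega) tendsto_id
    have := ((tendsto_pressure d hd hσ hx).2.comp hsub).mul_const ((L : ℝ) ^ d)
    refine this.congr fun k => ?_
    have e1 : (k + 1) * L - 1 + 1 = (k + 1) * L :=
      Nat.sub_add_cancel (Nat.mul_pos k.succ_pos hL)
    have hLr : (L : ℝ) ^ d ≠ 0 := pow_ne_zero _ (Nat.cast_ne_zero.2 hL.ne')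
    simp only [Function.comp_apply]
    rw [torusPressure_congr d e1, e1]
    push_cast
    rw [mul_pow]
    field_simp
  have h2 : Tendsto (fun k : ℕ => torusPressure d ((k + 1) * L) σ x / ((k : ℝ) + 1) ^ d) atTop
      (𝓝 (freePressure d L σ x + d / 2 * x ^ 2 * (L : ℝ) ^ (d - 1) *
        (1 + ∫ t in (0 : ℝ)..1, infCorridorMean d L σ x t))) := by
    have := ((tendsto_integral_torusCorridorMean d L hd hσ hx).const_add 1).const_mul
      (d / 2 * x ^ 2 * (L : ℝ) ^ (d - 1))
    refine (this.const_add (freePressure d L σ x)).congr fun k => ?_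
    have hk : ((k : ℝ) + 1) ^ d ≠ 0 := by positivity
    rw [torusPressure_eq d L (k + 1) hd hσ hx]
    push_cast
    rw [mul_div_cancel_left₀ _ hk]
  rw [freeSurface, tendsto_nhds_unique h1 h2]
  ring

end SurfacePressure

end EA

end

theorem theorem3 (d : ℕ) (hd : 1 ≤ d) (L : ℕ) [NeZero L] (σ x : ℝ) (hσ : 0 < σ) (hx : 0 ≤ x) :
    -- the limiting pressure per site exists and is the same for free and periodic boundaries
    Tendsto (fun N : ℕ => EA.freePressure d N σ x / (N : ℝ) ^ d) atTop
      (𝓝 (EA.limitPressure d σ x)) ∧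
    Tendsto (fun N : ℕ => EA.torusPressure d (N + 1) σ x / ((N + 1 : ℕ) : ℝ) ^ d) atTop
      (𝓝 (EA.limitPressure d σ x)) ∧
    -- the infinite-system correlations of the corridor bonds, and the corridor average, exist as
    -- limits of those of the tori of side `k L`, for all but countably many `t`
    {t : ℝ | t ∈ Set.Icc (0 : ℝ) 1 ∧
      ¬ ((∀ (n : Fin d → ℤ) (i : Fin d), (L : ℤ) ∣ n i + 1 →
          Tendsto (fun k : ℕ => EA.torusCorr d ((k + 1) * L) L σ x t n i) atTop
            (𝓝 (EA.infCorr d L σ x t n i))) ∧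
        Tendsto (fun k : ℕ => EA.torusCorridorMean d ((k + 1) * L) L σ x t) atTop
          (𝓝 (EA.infCorridorMean d L σ x t)))}.Countable ∧
    IntervalIntegrable (fun t => EA.infCorridorMean d L σ x t) volume 0 1 ∧
    IntervalIntegrable (fun t => EA.torusCorridorMean d L L σ x t) volume 0 1 ∧
    -- the integral representation for free boundaries
    EA.freeSurface d L σ x =
      -((d : ℝ) / 2 * x ^ 2 * (L : ℝ) ^ (d - 1) *
        (1 + ∫ t in (0 : ℝ)..1, EA.infCorridorMean d L σ x t)) ∧
    -- surface order and sign
    (d : ℝ) / 2 * x ^ 2 * (L : ℝ) ^ (d - 1) ≤ -EA.freeSurface d L σ x ∧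
    -EA.freeSurface d L σ x ≤ (d : ℝ) * x ^ 2 * (L : ℝ) ^ (d - 1) ∧
    EA.freeSurface d L σ x ≤ 0 ∧
    -- the integral representation for periodic boundaries
    EA.torusSurface d L σ x =
      1 / 2 * (d : ℝ) * x ^ 2 * (L : ℝ) ^ (d - 1) *
        ((∫ t in (0 : ℝ)..1, EA.torusCorridorMean d L L σ x t) -
          ∫ t in (0 : ℝ)..1, EA.infCorridorMean d L σ x t) := by
  obtain ⟨hfree, htorus⟩ := EA.tendsto_pressure d hd hσ hx
  have hrep := EA.freeSurface_eq d L hd hσ hx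
  obtain ⟨hI0, hI1⟩ := EA.integral_infCorridorMean_mem_Icc d L hd hσ hx
  have hone : ∀ t, EA.torusCorridorMean d L L σ x t = EA.torusCorridorMean d (1 * L) L σ x t :=
    EA.torusCorridorMean_congr d L (one_mul L).symm σ x
  have hA : 0 ≤ (d : ℝ) / 2 * x ^ 2 * (L : ℝ) ^ (d - 1) := by positivity
  have hlow := mul_nonneg hA hI0
  have hupp := mul_nonneg hA (sub_nonneg.2 hI1)
  refine ⟨hfree, htorus, ?_, EA.intervalIntegrable_infCorridorMean d L hd hσ hx, ?_, hrep,
    ?_, ?_, ?_, ?_⟩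
  · obtain ⟨E, hE, h⟩ := EA.exists_countable_tendsto d L hd hσ hx
    refine hE.mono fun t ht => ?_
    by_contra htE
    exact ht.2 (h t ht.1 htE)
  · simp only [hone]
    exact (EA.monotone_torusCorridorMean d L 1 hσ hx).intervalIntegrable
  · rw [hrep]; linarith
  · rw [hrep]; linarith
  · rw [hrep]; linarith
  -- The exact formula for a single box expresses the torus pressure through the box pressure;
  -- adding the representation for free boundaries cancels the latter.
  · have h := EA.torusPressure_eq d L 1 hd hσ hx
    rw [EA.torusPressure_congr d (one_mul L)] at h
    simp only [← hone] at h
    rw [EA.freeSurface] at hrep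
    rw [EA.torusSurface]
    push_cast at h
    rw [one_pow, one_mul] at h
    linear_combination h + hrep
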